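/- Let $M$ be a smooth real supermanifold of dimension $p|q$ with an odd Poisson (Schouten) bracket $\{\cdot,\cdot\}$, let $\rho$ be a nondegenerate (basis) volume form on $M$, and let $w\in\mathbb R$. For a homogeneous function $f$ of parity $\tilde f$ let $X_f=(-1)^{\tilde f+1}\{f,\cdot\}$ be its Hamiltonian vector field. A density of weight $w$ is given in local coordinates by $s_x\,|Dx|^w$, with $s_x=s_y\,|\mathrm{Ber}(\partial y/\partial x)|^w$. The Lie derivative of a density of weight $w$ along a homogeneous vector field $X=X^a\partial_a$ has the coefficient $X s_x+w\big(\sum_a(-1)^{\tilde a(\tilde X+1)}\partial_aX^a\big)s_x$, and this is again a density of weight $w$. The odd Laplace operator on functions is the additive operator $\Delta_\rho$ with $\Delta_\rho f=(L_{X_f}\rho)/\rho$ for homogeneous $f$. Every density of weight $w$ is $s\rho^w$ for a unique function $s$ (where $\rho^w$ has the coefficients $|\rho_x|^w$), and on densities of weight $w$ one defines the Laplacian by $\Delta_\rho(s\rho^w):=(\Delta_\rho s)\rho^w$. These objects are well defined, and for every homogeneous function $f$ the commutator of this Laplacian with multiplication by $f$, $[\Delta_\rho,f]=\Delta_\rho\circ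 f-(-1)^{\tilde f}f\circ\Delta_\rho$, is given on densities of weight $w$ by $$[\Delta_\rho,f]=2L_{X_f}+(1-2w)\,\Delta_\rho f .$$ If the bracket does not vanish identically on the functions on $M$, then the extra term $(1-2w)\Delta_\rho f$ vanishes for all functions $f$ if and only if $w=1/2$. -/

import Mathlib

open CategoryTheory TopologicalSpace Opposite
open scoped TensorProduct ContDiff

/-! ## Signs and noncommutative linear algebra -/

/-- The sign `(-1)^i` of a parity `i`. -/
def paritySign (i : ZMod 2) : ℝ := if i = 0 then 1 else -1

/-- The parity of the `a`-th coordinate in dimension `p|q`: the first `p` coordinates are even, the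
last `q` are odd. -/
def coordParity {p q : ℕ} : Fin p ⊕ Fin q → ZMod 2 := Sum.elim (fun _ => 0) (fun _ => 1)

/-- The determinant `∑ sgn(σ) a_{1σ(1)} ⋯ a_{nσ(n)}`, for matrices with (commuting) entries in a
ring that is not itself commutative. -/
def ringDet {R : Type*} [Ring R] {n : ℕ} (A : Matrix (Fin n) (Fin n) R) : R :=
  ∑ σ : Equiv.Perm (Fin n), ((Equiv.Perm.sign σ : ℤˣ) : ℤ) • (List.ofFn fun i => A i (σ i)).prod

/-- The Berezinian `det(A - B D⁻¹ C) (det D)⁻¹` of an even invertible supermatrix with blocks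
`A B` (first row) and `C D` (second row). -/
noncomputable def berezinian {R : Type*} [Ring R] {p q : ℕ}
    (J : Matrix (Fin p ⊕ Fin q) (Fin p ⊕ Fin q) R) : R :=
  ringDet (J.toBlocks₁₁ - J.toBlocks₁₂ * Ring.inverse J.toBlocks₂₂ * J.toBlocks₂₁) *
    Ring.inverse (ringDet J.toBlocks₂₂)

/-! ## Smooth functions on open subsets of `ℝ^p` -/

section Smooth

variable {p : ℕ}

/-- Extension by zero of a function on an open set. -/
noncomputable def extendZero {V : Opens (EuclideanSpace ℝ (Fin p))} (f : V → ℝ) :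
    EuclideanSpace ℝ (Fin p) → ℝ :=
  Function.extend Subtype.val f 0

theorem extendZero_apply {V : Opens (EuclideanSpace ℝ (Fin p))} (f : V → ℝ)
    {x : EuclideanSpace ℝ (Fin p)} (hx : x ∈ V) : extendZero f x = f ⟨x, hx⟩ :=
  Subtype.val_injective.extend_apply f 0 ⟨x, hx⟩

/-- The algebra `C^∞(V)` of smooth real functions on an open set `V ⊆ ℝ^p`. -/
def SmoothFun (V : Opens (EuclideanSpace ℝ (Fin p))) : Subalgebra ℝ (V → ℝ) where
  carrier := {f | ContDiffOn ℝ ∞ (extendZero f) V}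
  mul_mem' {f g} hf hg := by
    refine (ContDiffOn.mul hf hg).congr fun x hx => ?_
    simp [extendZero_apply _ (show x ∈ V from hx)]
  add_mem' {f g} hf hg := by
    refine (ContDiffOn.add hf hg).congr fun x hx => ?_
    simp [extendZero_apply _ (show x ∈ V from hx)]
  algebraMap_mem' r := by
    refine (contDiffOn_const (c := r)).congr fun x hx => ?_
    simp [extendZero_apply _ (show x ∈ V from hx)]

/-- Restriction of smooth functions to a smaller open set. -/
def SmoothFun.restrict {V' V : Opens (EuclideanSpace ℝ (Fin p))} (h : V' ≤ V) :
    SmoothFun V →ₐ[ℝ] SmoothFun V' where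
  toFun f := ⟨fun x => f.1 ⟨x.1, h x.2⟩, by
    refine (ContDiffOn.mono f.2 h).congr fun x hx => ?_
    rw [extendZero_apply _ (show x ∈ V' from hx), extendZero_apply _ (h hx)]⟩
  map_one' := rfl
  map_mul' _ _ := rfl
  map_zero' := rfl
  map_add' _ _ := rfl
  commutes' _ := rfl

/-- The partial derivative `∂/∂x^i` on `C^∞(V)`. -/
noncomputable def SmoothFun.pderiv (V : Opens (EuclideanSpace ℝ (Fin p))) (i : Fin p) :
    SmoothFun V →ₗ[ℝ] SmoothFun V where
  toFun f := ⟨fun x => fderiv ℝ (extendZero f.1) x.1 (EuclideanSpace.single i 1), by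
    have h : ContDiffOn ℝ ∞ (fderiv ℝ (extendZero f.1)) V :=
      ContDiffOn.fderiv_of_isOpen f.2 V.2 (by simp)
    refine (h.clm_apply (contDiffOn_const (c := EuclideanSpace.single i (1 : ℝ)))).congr
      fun x hx => ?_
    rw [extendZero_apply _ (show x ∈ V from hx)]⟩
  map_add' f g := by
    ext x
    have hd : ∀ k : SmoothFun V, DifferentiableAt ℝ (extendZero k.1) x.1 := fun k =>
      (k.2.contDiffAt (V.2.mem_nhds x.2)).differentiableAt (by simp)
    have : extendZero (f.1 + g.1) =ᶠ[nhds x.1] extendZero f.1 + extendZero g.1 := by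
      filter_upwards [V.2.mem_nhds x.2] with y hy
      simp [extendZero_apply _ (show y ∈ V from hy)]
    simp [this.fderiv_eq, fderiv_add (hd f) (hd g)]
  map_smul' r f := by
    ext x
    have hd : DifferentiableAt ℝ (extendZero f.1) x.1 :=
      (f.2.contDiffAt (V.2.mem_nhds x.2)).differentiableAt (by simp)
    have : extendZero (r • f.1) =ᶠ[nhds x.1] r • extendZero f.1 := by
      filter_upwards [V.2.mem_nhds x.2] with y hy
      simp [extendZero_apply _ (show y ∈ V from hy)]
    simp [this.fderiv_eq, fderiv_const_smul hd]

/-- The `i`-th coordinate function on `V`. -/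
def SmoothFun.coord (V : Opens (EuclideanSpace ℝ (Fin p))) (i : Fin p) : SmoothFun V :=
  ⟨fun x => x.1 i, by
    have h : ContDiff ℝ ∞ fun x : EuclideanSpace ℝ (Fin p) => x i := by fun_prop
    refine h.contDiffOn.congr fun x hx => ?_
    rw [extendZero_apply _ (show x ∈ V from hx)]⟩

open Classical in
/-- The smooth function `|b|^w b^{-k}` for a nowhere vanishing smooth function `b` (and `0` for a
function with zeros). -/
noncomputable def SmoothFun.absPowDiv {V : Opens (EuclideanSpace ℝ (Fin p))} (b : SmoothFun V)
    (w : ℝ) (k : ℕ) : SmoothFun V :=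
  if h : ∀ x, b.1 x ≠ 0 then
    ⟨fun x => |b.1 x| ^ w / b.1 x ^ k, by
      have h0 : ∀ x ∈ V, extendZero b.1 x ≠ 0 := fun x hx => by
        rw [extendZero_apply _ hx]; exact h _
      have h1 : ContDiffOn ℝ ∞ (fun x => |extendZero b.1 x| ^ w / extendZero b.1 x ^ k) V :=
        ((ContDiffOn.abs b.2 h0).rpow_const_of_ne fun x hx => abs_ne_zero.2 (h0 x hx)).div
          (ContDiffOn.pow b.2 k) fun x hx => pow_ne_zero k (h0 x hx)
      refine h1.congr fun x hx => ?_
      rw [extendZero_apply _ (show x ∈ V from hx), extendZero_apply _ (show x ∈ V from hx)]⟩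
  else 0

end Smooth

/-! ## Superdomains -/

section Superdomain

variable {p : ℕ} (q : ℕ)

/-- The superalgebra `C^∞(V) ⊗ Λ(θ^1, …, θ^q)` of functions on the superdomain of dimension `p|q`
with underlying open set `V ⊆ ℝ^p`. -/
abbrev SuperFun (V : Opens (EuclideanSpace ℝ (Fin p))) : Type :=
  SmoothFun V ⊗[ℝ] ExteriorAlgebra ℝ (Fin q → ℝ)

/-- The parity automorphism: `+1` on even and `-1` on odd functions. -/
noncomputable def SuperFun.parity (V : Opens (EuclideanSpace ℝ (Fin p))) :
    SuperFun q V →ₐ[ℝ] SuperFun q V :=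
  Algebra.TensorProduct.map (AlgHom.id ℝ (SmoothFun V)) CliffordAlgebra.involute

/-- Restriction of functions to a smaller superdomain. -/
noncomputable def SuperFun.restrict {V' V : Opens (EuclideanSpace ℝ (Fin p))} (h : V' ≤ V) :
    SuperFun q V →ₐ[ℝ] SuperFun q V' :=
  Algebra.TensorProduct.map (SmoothFun.restrict h)
    (AlgHom.id ℝ (ExteriorAlgebra ℝ (Fin q → ℝ)))

/-- The standard coordinates `x^1, …, x^p, θ^1, …, θ^q`. -/
noncomputable def SuperFun.coord (V : Opens (EuclideanSpace ℝ (Fin p))) :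
    Fin p ⊕ Fin q → SuperFun q V :=
  Sum.elim (fun i => SmoothFun.coord V i ⊗ₜ[ℝ] 1)
    (fun j => 1 ⊗ₜ[ℝ] ExteriorAlgebra.ι ℝ (Pi.single j 1))

/-- The (left) partial derivatives `∂/∂x^i` and `∂/∂θ^j`. The latter is the contraction with the
`j`-th basis covector, an antiderivation of the exterior algebra. -/
noncomputable def SuperFun.pderiv (V : Opens (EuclideanSpace ℝ (Fin p))) :
    Fin p ⊕ Fin q → SuperFun q V →ₗ[ℝ] SuperFun q V :=
  Sum.elim
    (fun i => LinearMap.rTensor (ExteriorAlgebra ℝ (Fin q → ℝ)) (SmoothFun.pderiv V i))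
    (fun j => LinearMap.lTensor (SmoothFun V)
      (CliffordAlgebra.contractLeft (Q := (0 : QuadraticForm ℝ (Fin q → ℝ)))
        (LinearMap.proj j : (Fin q → ℝ) →ₗ[ℝ] ℝ)))

variable {q}

/-- The body of a function: set all `θ^j` to zero. -/
noncomputable def SuperFun.body {V : Opens (EuclideanSpace ℝ (Fin p))} :
    SuperFun q V →ₐ[ℝ] SmoothFun V :=
  (Algebra.TensorProduct.rid ℝ ℝ (SmoothFun V)).toAlgHom.comp
    (Algebra.TensorProduct.map (AlgHom.id ℝ (SmoothFun V)) ExteriorAlgebra.algebraMapInv)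

/-- The real power `|g|^w` of an invertible even function `g = b + n` with body `b` and nilpotent
part `n`, by the (finite) binomial series `∑ (w choose k) |b|^w b^{-k} n^k`. -/
noncomputable def SuperFun.absPow {V : Opens (EuclideanSpace ℝ (Fin p))} (g : SuperFun q V)
    (w : ℝ) : SuperFun q V :=
  ∑ k ∈ Finset.range (q + 1), Ring.choose w k •
    ((SmoothFun.absPowDiv (SuperFun.body g) w k ⊗ₜ[ℝ] 1) * (g - SuperFun.body g ⊗ₜ[ℝ] 1) ^ k)

end Superdomain

/-! ## Supermanifolds -/

universe u

/-- A second countable Hausdorff space with a sheaf of real superalgebras. The `ℤ/2`-grading is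
given by the parity automorphism, which is `+1` on even and `-1` on odd elements. -/
structure SuperSpace where
  carrier : TopCat.{u}
  t2 : T2Space carrier
  secondCountable : SecondCountableTopology carrier
  sheaf : TopCat.Sheaf (AlgCat.{u} ℝ) carrier
  parity : sheaf.presheaf ⟶ sheaf.presheaf
  parity_comp : parity ≫ parity = 𝟙 sheaf.presheaf

namespace SuperSpace

/-- The algebra of functions over the open set `U`. -/
abbrev O (M : SuperSpace.{u}) (U : Opens M.carrier) : Type u :=
  (M.sheaf.presheaf.obj (op U) : AlgCat.{u} ℝ)

/-- Restriction of functions. -/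
def res (M : SuperSpace.{u}) {U V : Opens M.carrier} (h : U ≤ V) : M.O V →ₐ[ℝ] M.O U :=
  (M.sheaf.presheaf.map (homOfLE h).op).hom

/-- The parity automorphism over `U`. -/
def par (M : SuperSpace.{u}) (U : Opens M.carrier) : M.O U →ₐ[ℝ] M.O U :=
  (M.parity.app (op U)).hom

/-- The homogeneous functions of parity `i` over `U`. -/
def homog (M : SuperSpace.{u}) (U : Opens M.carrier) (i : ZMod 2) : Submodule ℝ (M.O U) :=
  LinearMap.ker ((M.par U).toLinearMap - paritySign i • LinearMap.id)

/-- The homogeneous component of parity `i` of a function. -/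
noncomputable def component (M : SuperSpace.{u}) {U : Opens M.carrier} (i : ZMod 2) (f : M.O U) :
    M.O U :=
  (1 / 2 : ℝ) • (f + paritySign i • M.par U f)

theorem mem_homog {M : SuperSpace.{u}} {U : Opens M.carrier} {i : ZMod 2} {f : M.O U} :
    f ∈ M.homog U i ↔ M.par U f = paritySign i • f := by
  simp [homog, sub_eq_zero]

theorem par_par (M : SuperSpace.{u}) {U : Opens M.carrier} (f : M.O U) :
    M.par U (M.par U f) = f := by
  have h := congrArg (fun t => (t.app (op U)).hom f) M.parity_comp
  exact h

theorem component_mem (M : SuperSpace.{u}) {U : Opens M.carrier} (i : ZMod 2) (f : M.O U) :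
    M.component i f ∈ M.homog U i := by
  have h : paritySign i * paritySign i = 1 := by unfold paritySign; split_ifs <;> norm_num
  rw [mem_homog, component, map_smul, map_add, map_smul, par_par, smul_comm (paritySign i),
    smul_add (paritySign i), smul_smul, h, one_smul, add_comm]

theorem res_par (M : SuperSpace.{u}) {U V : Opens M.carrier} (h : U ≤ V) (f : M.O V) :
    M.res h (M.par V f) = M.par U (M.res h f) := by
  have h := congrArg (fun t => t.hom f) (M.parity.naturality (homOfLE h).op)
  exact h.symm

theorem res_mem_homog {M : SuperSpace.{u}} {U V : Opens M.carrier} (h : U ≤ V) {i : ZMod 2}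
    {f : M.O V} (hf : f ∈ M.homog V i) : M.res h f ∈ M.homog U i := by
  rw [mem_homog] at hf ⊢
  rw [← res_par, hf, map_smul]

/-- The image in `ℝ^p` of an open set under a partially defined homeomorphism. -/
def image {p : ℕ} {X : TopCat.{u}} (e : OpenPartialHomeomorph X (EuclideanSpace ℝ (Fin p)))
    (W : Opens X) : Opens (EuclideanSpace ℝ (Fin p)) :=
  ⟨e.target ∩ e.symm ⁻¹' W, e.isOpen_inter_preimage_symm W.2⟩

theorem image_mono {p : ℕ} {X : TopCat.{u}}
    (e : OpenPartialHomeomorph X (EuclideanSpace ℝ (Fin p))) {W' W : Opens X} (h : W' ≤ W) :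
    image e W' ≤ image e W :=
  fun _ hx => ⟨hx.1, h hx.2⟩

/-- A local coordinate system of dimension `p|q`: an isomorphism of an open part of `M` with a
superdomain, i.e. a homeomorphism of open sets together with parity preserving isomorphisms of
function algebras that are compatible with restriction. -/
structure Chart (M : SuperSpace.{u}) (p q : ℕ) where
  toHomeo : OpenPartialHomeomorph M.carrier (EuclideanSpace ℝ (Fin p))
  source : Opens M.carrier
  source_eq : (source : Set M.carrier) = toHomeo.source
  iso : ∀ W : Opens M.carrier, W ≤ source → M.O W ≃ₐ[ℝ] SuperFun q (image toHomeo W)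
  iso_res : ∀ (W' W : Opens M.carrier) (h : W' ≤ W) (hW : W ≤ source) (f : M.O W),
    iso W' (h.trans hW) (M.res h f) = SuperFun.restrict q (image_mono toHomeo h) (iso W hW f)
  iso_par : ∀ (W : Opens M.carrier) (hW : W ≤ source) (f : M.O W),
    iso W hW (M.par W f) = SuperFun.parity q _ (iso W hW f)

end SuperSpace

/-- A (smooth, real) supermanifold of dimension `p|q`. -/
structure Supermanifold (p q : ℕ) extends SuperSpace.{u} where
  exists_chart : ∀ x : carrier, ∃ c : SuperSpace.Chart toSuperSpace p q, x ∈ c.source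

namespace SuperSpace.Chart

variable {M : SuperSpace.{u}} {p q : ℕ} (c : M.Chart p q) {W : Opens M.carrier}
  (hW : W ≤ c.source)

/-- The coordinate functions of a chart. -/
noncomputable def coord (a : Fin p ⊕ Fin q) : M.O W :=
  (c.iso W hW).symm (SuperFun.coord q _ a)

/-- The partial derivatives with respect to the coordinates of a chart. -/
noncomputable def pderiv (a : Fin p ⊕ Fin q) : M.O W →ₗ[ℝ] M.O W :=
  (c.iso W hW).symm.toLinearMap ∘ₗ SuperFun.pderiv q _ a ∘ₗ (c.iso W hW).toLinearMap

/-- The power `|g|^w` of an invertible even function on an open part of a chart. -/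
noncomputable def absPow (g : M.O W) (w : ℝ) : M.O W :=
  (c.iso W hW).symm (SuperFun.absPow (c.iso W hW g) w)

/-- The Jacobi matrix `∂y^b/∂x^a` (`a` the row, `b` the column), where the `x^a` are the coordinates
of `c` and the `y^b` are the coordinates of `d`. -/
noncomputable def jacobian (d : M.Chart p q) (hd : W ≤ d.source) :
    Matrix (Fin p ⊕ Fin q) (Fin p ⊕ Fin q) (M.O W) :=
  Matrix.of fun a b => c.pderiv hW a (d.coord hd b)

end SuperSpace.Chart

namespace Supermanifold

variable {p q : ℕ}

/-- The local coordinate systems of a supermanifold. -/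
abbrev Coords (M : Supermanifold.{u} p q) : Type u := M.toSuperSpace.Chart p q

/-! ## Vector fields and odd Poisson brackets -/

/-- Homogeneous vector fields of parity `i`: derivations of parity `i` of the sheaf of functions. -/
structure VectorField (M : Supermanifold.{u} p q) (i : ZMod 2) where
  app : ∀ U : Opens M.carrier, M.O U →ₗ[ℝ] M.O U
  app_res : ∀ (U V : Opens M.carrier) (h : U ≤ V) (g : M.O V),
    app U (M.res h g) = M.res h (app V g)
  app_mem : ∀ (U : Opens M.carrier) (j : ZMod 2) (g : M.O U),
    g ∈ M.homog U j → app U g ∈ M.homog U (i + j)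
  leibniz : ∀ (U : Opens M.carrier) (j : ZMod 2) (g h : M.O U), g ∈ M.homog U j →
    app U (g * h) = app U g * h + paritySign (i * j) • (g * app U h)

/-- An odd Poisson (= Schouten) structure on a supermanifold, given by its odd bracket. -/
structure OddPoisson (M : Supermanifold.{u} p q) where
  bracket : ∀ U : Opens M.carrier, M.O U →ₗ[ℝ] M.O U →ₗ[ℝ] M.O U
  bracket_res : ∀ (U V : Opens M.carrier) (h : U ≤ V) (f g : M.O V),
    bracket U (M.res h f) (M.res h g) = M.res h (bracket V f g)
  bracket_mem : ∀ (U : Opens M.carrier) (i j : ZMod 2) (f g : M.O U),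
    f ∈ M.homog U i → g ∈ M.homog U j → bracket U f g ∈ M.homog U (i + j + 1)
  bracket_symm : ∀ (U : Opens M.carrier) (i j : ZMod 2) (f g : M.O U),
    f ∈ M.homog U i → g ∈ M.homog U j →
      bracket U f g = -(paritySign ((i + 1) * (j + 1)) • bracket U g f)
  leibniz : ∀ (U : Opens M.carrier) (i j : ZMod 2) (f g h : M.O U),
    f ∈ M.homog U i → g ∈ M.homog U j →
      bracket U f (g * h) = bracket U f g * h + paritySign ((i + 1) * j) • (g * bracket U f h)
  jacobi : ∀ (U : Opens M.carrier) (i j : ZMod 2) (f g h : M.O U),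
    f ∈ M.homog U i → g ∈ M.homog U j →
      bracket U f (bracket U g h) = bracket U (bracket U f g) h +
        paritySign ((i + 1) * (j + 1)) • bracket U g (bracket U f h)

/-- The Hamiltonian vector field `X_f = (-1)^{f+1} {f, ·}` of a homogeneous function `f`. -/
def OddPoisson.hamiltonian {M : Supermanifold.{u} p q} (P : M.OddPoisson) {i : ZMod 2} {f : M.O ⊤}
    (hf : f ∈ M.homog ⊤ i) : M.VectorField (i + 1) where
  app U := paritySign (i + 1) • P.bracket U (M.res le_top f)
  app_res U V h g := by
    have hres : M.res (le_top : U ≤ ⊤) f = M.res h (M.res (le_top : V ≤ ⊤) f) := by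
      have := congrArg (fun t => t.hom f)
        (M.sheaf.presheaf.map_comp (homOfLE (le_top : V ≤ ⊤)).op (homOfLE h).op)
      exact this
    simp only [LinearMap.smul_apply, map_smul, hres, P.bracket_res]
  app_mem U j g hg := by
    have h := P.bracket_mem U i j _ g (SuperSpace.res_mem_homog le_top hf) hg
    rw [add_right_comm] at h
    exact Submodule.smul_mem _ _ h
  leibniz U j g h hg := by
    simp only [LinearMap.smul_apply, P.leibniz U i j _ g h (SuperSpace.res_mem_homog le_top hf) hg,
      smul_add, smul_mul_assoc, mul_smul_comm, smul_comm (paritySign (i + 1))]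

/-! ## Densities -/

/-- Densities of weight `w`: in every coordinate system `x` a function `s_x`, the coefficient in
`s = s_x |Dx|^w`, with the transformation law `s_x = s_y |Ber (∂y/∂x)|^w` on overlaps. -/
noncomputable def Density (M : Supermanifold.{u} p q) (w : ℝ) :
    Submodule ℝ (∀ c : M.Coords, M.O c.source) where
  carrier := {s | ∀ c d : M.Coords,
    M.res (inf_le_left : c.source ⊓ d.source ≤ c.source) (s c) =
      M.res (inf_le_right : c.source ⊓ d.source ≤ d.source) (s d) *
        c.absPow inf_le_left (berezinian (c.jacobian inf_le_left d inf_le_right)) w}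
  add_mem' {s t} hs ht c d := by
    simp only [Pi.add_apply, map_add, hs c d, ht c d, add_mul]
  zero_mem' c d := by simp
  smul_mem' r s hs c d := by
    simp only [Pi.smul_apply, map_smul, hs c d, smul_mul_assoc]

variable {M : Supermanifold.{u} p q} {w : ℝ}

/-- The product of a function and a density. -/
noncomputable def mulDensity (f : M.O ⊤) (s : M.Density w) : M.Density w :=
  ⟨fun c => M.res le_top f * s.1 c, fun c d => by
    have hres : ∀ {U V : Opens M.carrier} (h : U ≤ V),
        M.res h (M.res (le_top : V ≤ ⊤) f) = M.res (le_top : U ≤ ⊤) f := fun {U V} h => by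
      have := congrArg (fun t => t.hom f)
        (M.sheaf.presheaf.map_comp (homOfLE (le_top : V ≤ ⊤)).op (homOfLE h).op)
      exact this.symm
    simp only [map_mul, hres, s.2 c d, mul_assoc]⟩

/-- Basis (nondegenerate) volume forms: even densities of weight `1` with invertible coefficients. -/
structure BasisVolume (M : Supermanifold.{u} p q) where
  toDensity : M.Density 1
  even : ∀ c : M.Coords, toDensity.1 c ∈ M.homog c.source 0
  isUnit : ∀ c : M.Coords, IsUnit (toDensity.1 c)

/-- `t` is the density `ρ^w`: its coefficients are the powers `|ρ_x|^w` of those of `ρ`. -/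
def IsPower (ρ : M.BasisVolume) (t : M.Density w) : Prop :=
  ∀ c : M.Coords, t.1 c = c.absPow le_rfl (ρ.toDensity.1 c) w

/-- `t` is the Lie derivative `L_X s` of the density `s` of weight `w`: in every coordinate system,
`t_x = X s_x + w (∑_a (-1)^{a(X+1)} ∂_a X^a) s_x`, where `X^a = X x^a`. -/
def IsLieDerivative {i : ZMod 2} (X : M.VectorField i) (s t : M.Density w) : Prop :=
  ∀ c : M.Coords, t.1 c = X.app c.source (s.1 c) +
    w • ((∑ a, paritySign (coordParity a * (i + 1)) •
      c.pderiv le_rfl a (X.app c.source (c.coord le_rfl a))) * s.1 c)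

open Classical in
/-- The Lie derivative `L_X s` of a density. -/
noncomputable def lieDerivative {i : ZMod 2} (X : M.VectorField i) (s : M.Density w) :
    M.Density w :=
  if h : ∃ t, IsLieDerivative X s t then h.choose else 0

open Classical in
/-- The density `ρ^w`. -/
noncomputable def BasisVolume.power (ρ : M.BasisVolume) (w : ℝ) : M.Density w :=
  if h : ∃ t, IsPower ρ t then h.choose else 0

open Classical in
/-- The function `s / ρ^w`, i.e. the function `σ` such that `s = σ ρ^w`. -/
noncomputable def BasisVolume.quotient (ρ : M.BasisVolume) (s : M.Density w) : M.O ⊤ :=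
  if h : ∃ σ, s = mulDensity σ (ρ.power w) then h.choose else 0

open Classical in
/-- The divergence `L_X ρ / ρ` of a vector field. -/
noncomputable def BasisVolume.divergence (ρ : M.BasisVolume) {i : ZMod 2} (X : M.VectorField i) :
    M.O ⊤ :=
  if h : ∃ g, mulDensity g ρ.toDensity = lieDerivative X ρ.toDensity then h.choose else 0

/-- The odd Laplace operator on functions: `Δ_ρ f = div_ρ X_f` for homogeneous `f`, extended
additively to all functions. -/
noncomputable def OddPoisson.laplacian (P : M.OddPoisson) (ρ : M.BasisVolume) (f : M.O ⊤) :
    M.O ⊤ :=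
  ρ.divergence (P.hamiltonian (M.component_mem 0 f)) +
    ρ.divergence (P.hamiltonian (M.component_mem 1 f))

/-- The odd Laplace operator on densities of weight `w`: `Δ_ρ (σ ρ^w) = (Δ_ρ σ) ρ^w`. -/
noncomputable def OddPoisson.densityLaplacian (P : M.OddPoisson) (ρ : M.BasisVolume)
    (s : M.Density w) : M.Density w :=
  mulDensity (P.laplacian ρ (ρ.quotient s)) (ρ.power w)

end Supermanifold

/-! ## The exterior algebra -/

namespace ExteriorAlgebra

/-! ### Sign rules and the augmentation ideal of the exterior algebra. -/

section Commutation

variable {R V : Type*} [CommRing R] [AddCommGroup V] [Module R V]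

/-! The commutator formula comes from two identities. First, `Δ_ρ` is a second order operator
generating the bracket, `Δ(fg) = (Δf) g + (-1)^f f Δg + 2 X_f g` (`OddPoisson.laplacian_mul`): the
field `X_{fg}` is a signed sum of `f X_g` and `g X_f`, and taking divergences produces, besides the
two expected terms, the derivatives `X_g f` and `X_f g`, which coincide up to sign and add up.
Secondly, `L_X (σ ρ^w) = (X σ + w (div_ρ X) σ) ρ^w`. Hence `[Δ_ρ, f]` sends `σ ρ^w` to `(2 X_f σ +
(Δf) σ) ρ^w`, while `2 L_{X_f}` sends it to `(2 X_f σ + 2w (Δf) σ) ρ^w`; the difference is `(1 - 2w)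
Δf`. If `w ≠ 1/2` and this term always vanishes, then `Δ = 0`, and the product formula leaves `2 X_f
g = 0`, so the bracket is zero on functions.

Most of the work is in showing that the objects exist. The Lie derivative is a density because `D
Ber = (div_y D - div_x D) Ber` for the Jacobi matrix of a coordinate change. This logarithmic
derivative uses the Schur complement and the graded cyclicity of traces
(`IsSuperDer.map_berezinian`), together with the expansion `D = ∑ D(x^a) ∂_a` of derivations, which
rests on Hadamard's lemma (`Chart.superDer_apply`).

Powers `|g|^w` are finite binomial series in the nilpotent part of `g`. They are handled through the
equation `g D h = w h D g`: its invertible even solutions are determined by their values at points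
(`Chart.eq_of_powerEquation`), whence independence of the chart and multiplicativity. Finally,
quotients by `ρ^w` agree on overlaps and are glued by the sheaf property. -/

theorem ι_mul_eq_involute_mul_ι (v : V) (a : ExteriorAlgebra R V) :
    ι R v * a = CliffordAlgebra.involute a * ι R v := by
  induction a using ExteriorAlgebra.induction with
  | algebraMap r => rw [AlgHom.commutes, Algebra.commutes]
  | ι w =>
    rw [CliffordAlgebra.involute_ι, neg_mul, eq_neg_iff_add_eq_zero]
    exact ι_add_mul_swap v w
  | mul a b ha hb => rw [← mul_assoc, ha, mul_assoc, hb, map_mul, mul_assoc]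
  | add a b ha hb => rw [mul_add, ha, hb, map_add, add_mul]

theorem mul_comm_of_involute_eq {b : ExteriorAlgebra R V}
    (hb : CliffordAlgebra.involute b = b) (a : ExteriorAlgebra R V) : a * b = b * a := by
  induction a using ExteriorAlgebra.induction with
  | algebraMap r => rw [Algebra.commutes]
  | ι w => rw [ι_mul_eq_involute_mul_ι, hb]
  | mul a c ha hc => rw [mul_assoc, hc, ← mul_assoc, ha, mul_assoc]
  | add a c ha hc => rw [mul_add, ← ha, ← hc, add_mul]

theorem mul_eq_mul_involute_of_involute_eq_neg {b : ExteriorAlgebra R V}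
    (hb : CliffordAlgebra.involute b = -b) (a : ExteriorAlgebra R V) :
    a * b = b * CliffordAlgebra.involute a := by
  induction a using ExteriorAlgebra.induction with
  | algebraMap r => rw [Algebra.commutes, AlgHom.commutes]
  | ι w => rw [ι_mul_eq_involute_mul_ι, hb, CliffordAlgebra.involute_ι, neg_mul, mul_neg]
  | mul a c ha hc => rw [mul_assoc, hc, ← mul_assoc, ha, mul_assoc, map_mul]
  | add a c ha hc => rw [map_add, mul_add, ← ha, ← hc, add_mul]

theorem algebraMapInv_ι (v : V) : algebraMapInv (ι R v) = 0 := by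
  simp [algebraMapInv]

theorem mul_ι_eq_ι_mul_involute (a : ExteriorAlgebra R V) (v : V) :
    a * ι R v = ι R v * CliffordAlgebra.involute a := by
  rw [ι_mul_eq_involute_mul_ι, CliffordAlgebra.involute_involute]

/-- The augmentation ideal is `V · Λ`. With `ε` the augmentation, the inductive step is `ab -
ε(a)ε(b) = (a - ε(a)) b + ε(a) (b - ε(b))`. -/
theorem sub_algebraMapInv_mem (a : ExteriorAlgebra R V) :
    a - algebraMap R _ (algebraMapInv a) ∈ LinearMap.range (ι R : V →ₗ[R] _) * ⊤ := by
  induction a using ExteriorAlgebra.induction with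
  | algebraMap r => simp [algebraMap_leftInverse V r]
  | ι w =>
    rw [algebraMapInv_ι, map_zero, sub_zero, ← mul_one (ι R w)]
    exact Submodule.mul_mem_mul (LinearMap.mem_range_self _ _) trivial
  | mul a b ha hb =>
    have h : a * b - algebraMap R _ (algebraMapInv (a * b)) =
        (a - algebraMap R _ (algebraMapInv a)) * b +
          algebraMapInv a • (b - algebraMap R _ (algebraMapInv b)) := by
      rw [map_mul, map_mul, Algebra.smul_def]
      noncomm_ring
    rw [h]
    refine Submodule.add_mem _ ?_ (Submodule.smul_mem _ _ hb)
    have h2 := Submodule.mul_mem_mul ha (Submodule.mem_top (x := b))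
    rw [mul_assoc] at h2
    exact (mul_le_mul' le_rfl le_top :
      _ ≤ LinearMap.range (ι R : V →ₗ[R] _) * ⊤) h2
  | add a b ha hb =>
    have h : a + b - algebraMap R _ (algebraMapInv (a + b)) =
        (a - algebraMap R _ (algebraMapInv a)) + (b - algebraMap R _ (algebraMapInv b)) := by
      rw [map_add, map_add]
      abel
    rw [h]
    exact Submodule.add_mem _ ha hb

/-- A vector moves to the left past any element at the cost of the involution, so the vectors in an
`n`-fold product can be gathered in front. -/
theorem range_ι_mul_top_pow_le (n : ℕ) :
    (LinearMap.range (ι R : V →ₗ[R] _) * ⊤) ^ n ≤ LinearMap.range (ι R : V →ₗ[R] _) ^ n * ⊤ := by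
  induction n with
  | zero => rw [pow_zero, pow_zero, one_mul]; exact le_top
  | succ n ih =>
    have h : (⊤ : Submodule R (ExteriorAlgebra R V)) * LinearMap.range (ι R : V →ₗ[R] _) ≤
        LinearMap.range (ι R : V →ₗ[R] _) * ⊤ := by
      rw [Submodule.mul_le]
      rintro a - _ ⟨v, rfl⟩
      rw [mul_ι_eq_ι_mul_involute]
      exact Submodule.mul_mem_mul (LinearMap.mem_range_self _ _) trivial
    calc _ ≤ LinearMap.range (ι R : V →ₗ[R] _) ^ n * ⊤ *
          (LinearMap.range (ι R : V →ₗ[R] _) * ⊤) := by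
          rw [pow_succ]; exact mul_le_mul' ih le_rfl
      _ = LinearMap.range (ι R : V →ₗ[R] _) ^ n *
          (⊤ * LinearMap.range (ι R : V →ₗ[R] _)) * ⊤ := by simp only [mul_assoc]
      _ ≤ LinearMap.range (ι R : V →ₗ[R] _) ^ n *
          (LinearMap.range (ι R : V →ₗ[R] _) * ⊤) * ⊤ :=
          mul_le_mul' (mul_le_mul' le_rfl h) le_rfl
      _ = LinearMap.range (ι R : V →ₗ[R] _) ^ (n + 1) * (⊤ * ⊤) := by
          rw [pow_succ]; simp only [mul_assoc]
      _ ≤ _ := mul_le_mul' le_rfl le_top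

end Commutation

section Field

variable {K : Type*} [Field K] {q : ℕ}

/-- The power lies in `V^{q+1} · Λ`, and the exterior power of degree `q + 1` of a `q`-dimensional
space is zero. This uniform exponent is why the binomial series may stop at degree `q`. -/
theorem pow_eq_zero_of_algebraMapInv_eq_zero {a : ExteriorAlgebra K (Fin q → K)}
    (ha : algebraMapInv a = 0) : a ^ (q + 1) = 0 := by
  have h : a ∈ LinearMap.range (ι K : (Fin q → K) →ₗ[K] _) * ⊤ := by
    simpa [ha] using sub_algebraMapInv_mem a
  have h2 := range_ι_mul_top_pow_le (q + 1) (Submodule.pow_mem_pow _ h (q + 1))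
  have h3 : ⋀[K]^(q + 1) (Fin q → K) = ⊥ := by
    rw [← Submodule.finrank_eq_zero (R := K), exteriorPower.finrank_eq]
    simp
  rw [exteriorPower] at h3
  rwa [h3, Submodule.bot_mul, Submodule.mem_bot] at h2

end Field

section Contraction

variable {R : Type*} [CommRing R] {q : ℕ}

/-- The endomorphism that kills the `j`-th generator is `a ↦ a - e_j (∂_j a)`. -/
theorem map_sub_single_apply (j : Fin q) (a : ExteriorAlgebra R (Fin q → R)) :
    map (LinearMap.id - (LinearMap.single R (fun _ => R) j) ∘ₗ LinearMap.proj j) a =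
      a - ι R (Pi.single j 1) * CliffordAlgebra.contractLeft
        (Q := (0 : QuadraticForm R (Fin q → R))) (LinearMap.proj j : (Fin q → R) →ₗ[R] R) a := by
  induction a using CliffordAlgebra.left_induction with
  | algebraMap r => simp
  | add a b ha hb => rw [map_add, ha, hb, map_add, mul_add]; abel
  | ι_mul a v ha =>
    have hv : ι R ((LinearMap.id - (LinearMap.single R (fun _ => R) j) ∘ₗ LinearMap.proj j :
        (Fin q → R) →ₗ[R] (Fin q → R)) v) = ι R v - v j • ι R (Pi.single j 1) := by
      rw [← map_smul, ← map_sub]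
      congr 1
      ext k
      simp [Pi.single_apply]
    have h1 := ι_add_mul_swap (R := R) v (Pi.single j 1)
    have h2 := ι_sq_zero (R := R) (Pi.single j 1 : Fin q → R)
    rw [map_mul, ha, CliffordAlgebra.contractLeft_ι_mul]
    change map _ (ι R v) * _ = ι R v * a - _ * (v j • a - ι R v * _)
    rw [map_apply_ι, hv]
    set e := ι R (Pi.single j 1 : Fin q → R)
    set c := CliffordAlgebra.contractLeft (Q := (0 : QuadraticForm R (Fin q → R)))
      (LinearMap.proj j : (Fin q → R) →ₗ[R] R) a
    rw [sub_mul, mul_sub, mul_sub, mul_sub, ← mul_assoc, ← mul_assoc, ← mul_assoc,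
      eq_neg_of_add_eq_zero_left h1, smul_mul_assoc _ e e, h2, mul_smul_comm, smul_mul_assoc]
    simp
    abel

/-- By `map_sub_single_apply`, an element with `∂_j a = 0` is fixed by the substitution `θ^j = 0`.
Performing all these substitutions yields the endomorphism induced by the zero map, which is the
augmentation. -/
theorem eq_algebraMap_of_contractLeft_eq_zero {a : ExteriorAlgebra R (Fin q → R)}
    (ha : ∀ j, CliffordAlgebra.contractLeft (Q := (0 : QuadraticForm R (Fin q → R)))
      (LinearMap.proj j : (Fin q → R) →ₗ[R] R) a = 0) :
    a = algebraMap R _ (algebraMapInv a) := by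
  have h : ∀ s : Finset (Fin q), ∃ f : (Fin q → R) →ₗ[R] (Fin q → R), map f a = a ∧
      ∀ v j, j ∈ s → f v j = 0 := by
    intro s
    induction s using Finset.induction_on with
    | empty => exact ⟨LinearMap.id, by simp, by simp⟩
    | insert j s _ ih =>
      obtain ⟨f, hf, hs⟩ := ih
      refine ⟨(LinearMap.id - (LinearMap.single R (fun _ => R) j) ∘ₗ LinearMap.proj j) ∘ₗ f,
        ?_, fun v k hk => ?_⟩
      · rw [← map_comp_map, AlgHom.comp_apply, hf, map_sub_single_apply, ha, mul_zero, sub_zero]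
      · rcases eq_or_ne k j with rfl | hkj
        · simp
        · simp [hkj, hs v k ((Finset.mem_insert.1 hk).resolve_left hkj)]
  obtain ⟨f, hf, hs⟩ := h Finset.univ
  have hf0 : f = 0 := LinearMap.ext fun v => funext fun j => hs v j (Finset.mem_univ j)
  rw [hf0] at hf
  have h0 : map (0 : (Fin q → R) →ₗ[R] (Fin q → R)) =
      (Algebra.ofId R _).comp algebraMapInv := by
    ext v
    simp [algebraMapInv_ι]
  rw [h0] at hf
  exact hf.symm

end Contraction

end ExteriorAlgebra

/-! ## Hadamard's lemma and derivations of algebras of smooth functions -/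

section Hadamard

open MeasureTheory Set

variable {E : Type} [NormedAddCommGroup E] [NormedSpace ℝ E]

/-- The integral is the value at `0` of the convolution of the indicator of `(0, 1]` with the
reflected integrand. A bump function equal to `1` on `[0, 1]` gives the integrand the compact
support under which a convolution depends smoothly on parameters. -/
theorem contDiff_intervalIntegral_param {F : Type} [NormedAddCommGroup F] [NormedSpace ℝ F]
    [CompleteSpace F]
    {G : E → ℝ → F} (hG : ContDiff ℝ ∞ (Function.uncurry G)) :
    ContDiff ℝ ∞ fun x => ∫ t in (0 : ℝ)..1, G x t := by
  let b : ContDiffBump (0 : ℝ) := ⟨2, 3, by norm_num, by norm_num⟩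
  have h := contDiffOn_convolution_right_with_param_comp (𝕜 := ℝ) (μ := volume) (n := ⊤)
    (ContinuousLinearMap.lsmul ℝ ℝ : ℝ →L[ℝ] F →L[ℝ] F) (s := (univ : Set E))
    (v := fun _ : E => (0 : ℝ)) contDiffOn_const (f := indicator (Ioc (0 : ℝ) 1) fun _ => (1 : ℝ))
    (g := fun x s => b (-s) • G x (-s)) (k := Metric.closedBall 0 3) isOpen_univ
    (isCompact_closedBall _ _)
    (fun x s _ hs => by
      have : b (-s) = 0 := b.zero_of_le_dist (by
        simp only [Metric.mem_closedBall, not_le] at hs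
        simpa [Real.dist_eq] using hs.le)
      rw [this, zero_smul])
    ((locallyIntegrable_const _).indicator measurableSet_Ioc)
    (by
      refine ContDiff.contDiffOn ?_
      have h1 : ContDiff ℝ ∞ fun z : E × ℝ => b (-z.2) := b.contDiff.comp contDiff_snd.neg
      have h2 : ContDiff ℝ ∞ fun z : E × ℝ => (z.1, -z.2) := contDiff_fst.prodMk contDiff_snd.neg
      exact h1.smul (hG.comp h2))
  convert (contDiffOn_univ.1 h : ContDiff _ _ _) using 1
  funext x
  rw [convolution_def, intervalIntegral.integral_of_le zero_le_one, ← integral_indicator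
    measurableSet_Ioc]
  refine integral_congr_ae (Filter.Eventually.of_forall fun t => ?_)
  by_cases ht : t ∈ Ioc (0 : ℝ) 1
  · have : b t = 1 := b.one_of_mem_closedBall (by
      simp only [Metric.mem_closedBall, Real.dist_eq, sub_zero]
      rw [abs_of_pos ht.1]
      exact ht.2.trans (by norm_num))
    simp [ht, this]
  · simp [ht]

/-- Hadamard's lemma. -/
theorem exists_contDiff_eq_add_apply_sub {F : E → ℝ} (hF : ContDiff ℝ ∞ F) (x₀ : E) :
    ∃ H : E → E →L[ℝ] ℝ, ContDiff ℝ ∞ H ∧ ∀ x, F x = F x₀ + H x (x - x₀) := by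
  have hF' : ContDiff ℝ ∞ (fderiv ℝ F) := hF.fderiv_right (by simp)
  have hd : Differentiable ℝ F := hF.differentiable (by simp)
  have hG : ContDiff ℝ ∞ (Function.uncurry fun (x : E) (t : ℝ) => fderiv ℝ F (x₀ + t • (x - x₀))) :=
    hF'.comp (contDiff_const.add (contDiff_snd.smul (contDiff_fst.sub contDiff_const)))
  -- The fundamental theorem of calculus along the segment from `x₀` to `x`: `H x` is the mean of
  -- the differential of `F` on it.
  refine ⟨fun x => ∫ t in (0 : ℝ)..1, fderiv ℝ F (x₀ + t • (x - x₀)),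
    contDiff_intervalIntegral_param hG, fun x => ?_⟩
  have hc : Continuous fun t : ℝ => fderiv ℝ F (x₀ + t • (x - x₀)) :=
    hF'.continuous.comp (by fun_prop)
  have h1 : ∀ t : ℝ, HasDerivAt (fun t : ℝ => F (x₀ + t • (x - x₀)))
      (fderiv ℝ F (x₀ + t • (x - x₀)) (x - x₀)) t := fun t => by
    have h2 : HasDerivAt (fun t : ℝ => x₀ + t • (x - x₀)) (x - x₀) t := by
      simpa using ((hasDerivAt_id t).smul_const (x - x₀)).const_add x₀
    exact (hd _).hasFDerivAt.comp_hasDerivAt t h2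
  have h3 := intervalIntegral.integral_eq_sub_of_hasDerivAt (a := 0) (b := 1)
    (fun t _ => h1 t) ((hc.clm_apply continuous_const).intervalIntegrable 0 1)
  simp only [one_smul, zero_smul, add_zero, add_sub_cancel] at h3
  beta_reduce
  rw [ContinuousLinearMap.intervalIntegral_apply (hc.intervalIntegrable 0 1), h3]
  ring

end Hadamard

namespace SmoothFun

variable {p : ℕ} {V : Opens (EuclideanSpace ℝ (Fin p))}

/-- The restriction to `V` of a smooth function on `ℝ^p`. -/
def ofContDiff (V : Opens (EuclideanSpace ℝ (Fin p))) {F : EuclideanSpace ℝ (Fin p) → ℝ}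
    (hF : ContDiff ℝ ∞ F) : SmoothFun V :=
  ⟨fun x => F x.1, hF.contDiffOn.congr fun x hx => by
    rw [extendZero_apply _ (show x ∈ V from hx)]⟩

/-- A bump function supported inside `V` makes the product extend by zero to all of `ℝ^p`. Thus
Hadamard's lemma can be applied globally, with no convexity condition on `V`. -/
theorem exists_cutoff_mul_eq (f : SmoothFun V) (x : V) :
    ∃ (χ : SmoothFun V) (F : EuclideanSpace ℝ (Fin p) → ℝ) (hF : ContDiff ℝ ∞ F),
      χ.1 x = 1 ∧ χ * f = ofContDiff V hF := by
  obtain ⟨r, hr, hrV⟩ := Metric.isOpen_iff.1 V.2 x.1 x.2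
  let b : ContDiffBump x.1 := ⟨r / 4, r / 2, by positivity, by linarith⟩
  have hb : ContDiff ℝ ∞ b := b.contDiff
  refine ⟨ofContDiff V hb, fun y => b y * extendZero f.1 y, ?_, ?_, ?_⟩
  · rw [contDiff_iff_contDiffAt]
    intro y
    by_cases hy : y ∈ V
    · exact hb.contDiffAt.mul (f.2.contDiffAt (V.2.mem_nhds hy))
    · have hy2 : y ∉ tsupport b := by
        rw [b.tsupport_eq]
        intro h
        refine hy (hrV (Metric.closedBall_subset_ball ?_ h))
        change r / 2 < r
        linarith
      have h0 : (fun y => b y * extendZero f.1 y) =ᶠ[nhds y] fun _ => 0 := by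
        filter_upwards [(isClosed_tsupport b).isOpen_compl.mem_nhds hy2] with z hz
        rw [image_eq_zero_of_notMem_tsupport hz, zero_mul]
      exact contDiffAt_const.congr_of_eventuallyEq h0
  · exact b.one_of_mem_closedBall (Metric.mem_closedBall_self (by positivity))
  · ext y
    change b y.1 * f.1 y = b y.1 * extendZero f.1 y.1
    rw [extendZero_apply _ y.2]

/-- A derivation at a point that kills the coordinates vanishes. -/
theorem pointDerivation_eq_zero {N : Type*} [AddCommGroup N] [Module ℝ N] (x : V)
    (δ : SmoothFun V →ₗ[ℝ] N) (hδ : ∀ f g, δ (f * g) = f.1 x • δ g + g.1 x • δ f)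
    (hx : ∀ i, δ (coord V i) = 0) (f : SmoothFun V) : δ f = 0 := by
  have h1 : δ 1 = 0 := by
    have h := hδ 1 1
    simp only [mul_one, OneMemClass.coe_one, Pi.one_apply, one_smul] at h
    simpa using h
  have hc : ∀ r : ℝ, δ (algebraMap ℝ _ r) = 0 := fun r => by
    rw [Algebra.algebraMap_eq_smul_one, map_smul, h1, smul_zero]
  -- Subtracting the constant `f x` makes the function vanish at `x`. Then `δ (χ (f - f x)) = δ f`,
  -- because `χ x = 1`, so the cutoff is invisible to `δ`.
  obtain ⟨χ, F, hF, hχ, hf⟩ := exists_cutoff_mul_eq (f - algebraMap ℝ _ (f.1 x)) x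
  obtain ⟨H, hH, hFH⟩ := exists_contDiff_eq_add_apply_sub hF x.1
  have hF0 : F x.1 = 0 := by
    have := congrArg (fun g : SmoothFun V => g.1 x) hf
    simpa [ofContDiff] using this.symm
  have hHi : ∀ i, ContDiff ℝ ∞ fun y => H y (EuclideanSpace.single i (1 : ℝ)) := fun i =>
    hH.clm_apply contDiff_const
  -- Hadamard's decomposition `F = ∑ (x^i - x₀^i) H_i`. In each product the first factor vanishes at
  -- the point and is killed by `δ`.
  have hdec : ofContDiff V hF =
      ∑ i, (coord V i - algebraMap ℝ _ (x.1 i)) * ofContDiff V (hHi i) := by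
    ext y
    have h2 : y.1 - x.1 = ∑ i, (y.1 i - x.1 i) • EuclideanSpace.single i (1 : ℝ) := by
      ext j
      simp [Pi.single_apply]
    simp only [AddSubmonoidClass.coe_finsetSum, Finset.sum_apply]
    change F y.1 = ∑ i, (y.1 i - x.1 i) * H y.1 (EuclideanSpace.single i (1 : ℝ))
    rw [hFH, hF0, zero_add, h2, map_sum]
    simp
  have h3 : δ (ofContDiff V hF) = 0 := by
    rw [hdec, map_sum]
    refine Finset.sum_eq_zero fun i _ => ?_
    have h4 : (coord V i - algebraMap ℝ (SmoothFun V) (x.1 i)).1 x = 0 := by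
      change x.1 i - x.1 i = 0
      ring
    rw [hδ, h4, map_sub, hx, hc]
    simp
  have h5 : (f - algebraMap ℝ (SmoothFun V) (f.1 x)).1 x = 0 := by
    change f.1 x - f.1 x = 0
    ring
  rw [← hf, hδ, h5, hχ, map_sub, hc] at h3
  simpa using h3

end SmoothFun

/-! ## Supercommutative algebras and their derivations -/

theorem ZMod.two_cases (i : ZMod 2) : i = 0 ∨ i = 1 := by
  fin_cases i
  · exact Or.inl rfl
  · exact Or.inr rfl

@[simp] theorem paritySign_zero : paritySign 0 = 1 := by simp [paritySign]

@[simp] theorem paritySign_one : paritySign 1 = -1 := by simp [paritySign]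

theorem paritySign_add (i j : ZMod 2) : paritySign (i + j) = paritySign i * paritySign j := by
  have h : (1 + 1 : ZMod 2) = 0 := rfl
  rcases ZMod.two_cases i with rfl | rfl <;> rcases ZMod.two_cases j with rfl | rfl <;> simp [h]

@[simp] theorem paritySign_mul_self (i : ZMod 2) : paritySign i * paritySign i = 1 := by
  rcases ZMod.two_cases i with rfl | rfl <;> simp

@[simp] theorem paritySign_smul_smul {N : Type*} [AddCommGroup N] [Module ℝ N] (i : ZMod 2)
    (x : N) : paritySign i • paritySign i • x = x := by
  rw [smul_smul, paritySign_mul_self, one_smul]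

section SuperAlgebra

variable {R : Type*} [Ring R] [Algebra ℝ R] (π : R →ₐ[ℝ] R)

/-- The element `f` is homogeneous of parity `i`. -/
def IsHomog (i : ZMod 2) (f : R) : Prop := π f = paritySign i • f

/-- The algebra with the parity automorphism `π` is supercommutative. -/
structure IsSuperComm : Prop where
  invol : ∀ f, π (π f) = f
  comm : ∀ i j f g, IsHomog π i f → IsHomog π j g → f * g = paritySign (i * j) • (g * f)

/-- `D` is a derivation of parity `i`. -/
structure IsSuperDer (i : ZMod 2) (D : R →ₗ[ℝ] R) : Prop where
  mem : ∀ j g, IsHomog π j g → IsHomog π (i + j) (D g)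
  leibniz : ∀ j g h, IsHomog π j g → D (g * h) = D g * h + paritySign (i * j) • (g * D h)

variable {π} {i j k : ZMod 2} {f g h : R} {D D' : R →ₗ[ℝ] R}

theorem isHomog_zero_iff : IsHomog π 0 f ↔ π f = f := by simp [IsHomog]

namespace IsHomog

theorem mul (hf : IsHomog π i f) (hg : IsHomog π j g) : IsHomog π (i + j) (f * g) := by
  unfold IsHomog at *
  rw [map_mul, hf, hg, smul_mul_smul_comm, paritySign_add]

theorem add (hf : IsHomog π i f) (hg : IsHomog π i g) : IsHomog π i (f + g) := by
  unfold IsHomog at *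
  rw [map_add, hf, hg, smul_add]

theorem smul (r : ℝ) (hf : IsHomog π i f) : IsHomog π i (r • f) := by
  unfold IsHomog at *
  rw [map_smul, hf, smul_comm]

theorem neg (hf : IsHomog π i f) : IsHomog π i (-f) := by
  unfold IsHomog at *
  rw [map_neg, hf, smul_neg]

theorem sub (hf : IsHomog π i f) (hg : IsHomog π i g) : IsHomog π i (f - g) := by
  rw [sub_eq_add_neg]
  exact hf.add hg.neg

theorem zero (i : ZMod 2) : IsHomog π i (0 : R) := by simp [IsHomog]

theorem one : IsHomog π 0 (1 : R) := by simp [IsHomog]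

theorem sum {ι : Type*} {s : Finset ι} {F : ι → R} (hF : ∀ a ∈ s, IsHomog π i (F a)) :
    IsHomog π i (∑ a ∈ s, F a) := by
  unfold IsHomog at *
  rw [map_sum, Finset.smul_sum]
  exact Finset.sum_congr rfl hF

theorem pow (hf : IsHomog π 0 f) (n : ℕ) : IsHomog π 0 (f ^ n) := by
  rw [isHomog_zero_iff] at *
  rw [map_pow, hf]

theorem inverse (hf : IsHomog π 0 f) :
    IsHomog π 0 (Ring.inverse f) := by
  rw [isHomog_zero_iff] at *
  by_cases hu : IsUnit f
  · have h1 : Ring.inverse f * f = 1 := Ring.inverse_mul_cancel f hu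
    have h2 : π (Ring.inverse f) * f = 1 := by
      have := congrArg π h1
      rwa [map_mul, hf, map_one] at this
    exact hu.mul_right_cancel (h2.trans h1.symm)
  · rw [Ring.inverse_non_unit f hu, map_zero]

end IsHomog

namespace IsSuperComm

/-- Since `2` is invertible, every element is the sum of its even part `(f + π f)/2` and its odd
part `(f - π f)/2`. -/
theorem homog_induction (H : IsSuperComm π) {P : R → Prop}
    (hom : ∀ i f, IsHomog π i f → P f) (add : ∀ f g, P f → P g → P (f + g)) (f : R) : P f := by
  have h : f = (1 / 2 : ℝ) • (f + π f) + (1 / 2 : ℝ) • (f - π f) := by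
    rw [← smul_add, add_add_sub_cancel, ← two_smul ℝ f, smul_smul]
    norm_num
  rw [h]
  refine add _ _ (hom 0 _ (IsHomog.smul _ ?_)) (hom 1 _ (IsHomog.smul _ ?_))
  · simp [IsHomog, H.invol, add_comm]
  · simp [IsHomog, H.invol]

theorem even_mul (H : IsSuperComm π) (hf : IsHomog π 0 f) (g : R) : f * g = g * f := by
  refine H.homog_induction (P := fun g => f * g = g * f) (fun i g hg => ?_)
    (fun a b ha hb => ?_) g
  · simpa using H.comm 0 i f g hf hg
  · rw [mul_add, ha, hb, add_mul]

theorem commute (H : IsSuperComm π) (hf : IsHomog π 0 f) (g : R) : Commute f g := H.even_mul hf g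

end IsSuperComm

namespace IsSuperDer

theorem leibniz_even (hD : IsSuperDer π i D) (hg : IsHomog π 0 g) (h : R) :
    D (g * h) = D g * h + g * D h := by
  simpa using hD.leibniz 0 g h hg

theorem map_one (hD : IsSuperDer π i D) : D 1 = 0 := by
  simpa using hD.leibniz_even (IsHomog.one (π := π)) 1

theorem map_algebraMap (hD : IsSuperDer π i D) (r : ℝ) : D (algebraMap ℝ R r) = 0 := by
  rw [Algebra.algebraMap_eq_smul_one, map_smul, hD.map_one, smul_zero]

theorem add (hD : IsSuperDer π i D) (hD' : IsSuperDer π i D') : IsSuperDer π i (D + D') where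
  mem j g hg := (hD.mem j g hg).add (hD'.mem j g hg)
  leibniz j g h hg := by
    simp only [LinearMap.add_apply, hD.leibniz j g h hg, hD'.leibniz j g h hg, add_mul, mul_add,
      smul_add]
    abel

theorem smul (r : ℝ) (hD : IsSuperDer π i D) : IsSuperDer π i (r • D) where
  mem j g hg := (hD.mem j g hg).smul r
  leibniz j g h hg := by
    simp only [LinearMap.smul_apply, hD.leibniz j g h hg, smul_add, smul_mul_assoc,
      mul_smul_comm, smul_comm r]

theorem sub (hD : IsSuperDer π i D) (hD' : IsSuperDer π i D') : IsSuperDer π i (D - D') := by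
  have : D - D' = D + (-1 : ℝ) • D' := by
    ext x
    simp [sub_eq_add_neg]
  rw [this]
  exact hD.add (hD'.smul _)

theorem zero : IsSuperDer π i (0 : R →ₗ[ℝ] R) where
  mem j g _ := IsHomog.zero _
  leibniz j g h _ := by simp

theorem sum {ι : Type*} {s : Finset ι} {F : ι → R →ₗ[ℝ] R}
    (hF : ∀ a ∈ s, IsSuperDer π i (F a)) : IsSuperDer π i (∑ a ∈ s, F a) := by
  classical
  induction s using Finset.induction_on with
  | empty => exact zero
  | insert a s ha ih =>
    rw [Finset.sum_insert ha]
    exact (hF a (Finset.mem_insert_self _ _)).add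
      (ih fun b hb => hF b (Finset.mem_insert_of_mem hb))

/-- Moving `f` past `g` costs exactly the sign that the larger parity `k + i` of `f D` requires. -/
theorem mulLeft (H : IsSuperComm π) (hf : IsHomog π k f) (hD : IsSuperDer π i D) :
    IsSuperDer π (k + i) (LinearMap.mulLeft ℝ f ∘ₗ D) where
  mem j g hg := by
    rw [add_assoc]
    exact hf.mul (hD.mem j g hg)
  leibniz j g h hg := by
    have hfg := H.comm k j f g hf hg
    simp only [LinearMap.comp_apply, LinearMap.mulLeft_apply, hD.leibniz j g h hg, mul_add,
      mul_smul_comm, ← mul_assoc, hfg, smul_mul_assoc, smul_smul]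
    rw [add_mul, paritySign_add, mul_comm]

theorem commutator (hD : IsSuperDer π i D) (hD' : IsSuperDer π j D') :
    IsSuperDer π (i + j) (D ∘ₗ D' - paritySign (i * j) • (D' ∘ₗ D)) where
  mem k g hg := by
    refine IsHomog.sub ?_ (IsHomog.smul _ ?_)
    · rw [add_assoc]
      exact hD.mem _ _ (hD'.mem _ _ hg)
    · rw [add_comm i, add_assoc]
      exact hD'.mem _ _ (hD.mem _ _ hg)
  leibniz k g h hg := by
    simp only [LinearMap.sub_apply, LinearMap.smul_apply, LinearMap.comp_apply,
      hD'.leibniz k g h hg, hD.leibniz k g h hg, map_add, map_smul,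
      hD.leibniz k g _ hg, hD'.leibniz k g _ hg, hD.leibniz _ _ _ (hD'.mem k g hg),
      hD'.leibniz _ _ _ (hD.mem k g hg), sub_mul, mul_sub, mul_smul_comm, smul_mul_assoc,
      smul_add, smul_sub, smul_smul]
    -- The mixed terms `D g * D' h` and `D' g * D h` cancel; the signs are checked in the eight
    -- cases of parities.
    rcases ZMod.two_cases i with rfl | rfl <;> rcases ZMod.two_cases j with rfl | rfl <;>
      rcases ZMod.two_cases k with rfl | rfl <;>
      simp [show (1 + 1 : ZMod 2) = 0 from rfl] <;> abel

/-- `D` restricted to the even part commutes past inverses as expected. -/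
theorem map_inverse (H : IsSuperComm π) (hD : IsSuperDer π i D) (hg : IsHomog π 0 g)
    (hu : IsUnit g) : D (Ring.inverse g) = -(Ring.inverse g * Ring.inverse g * D g) := by
  have h1 := hD.leibniz_even hg (Ring.inverse g)
  rw [Ring.mul_inverse_cancel g hu, hD.map_one] at h1
  have h2 : g * D (Ring.inverse g) = -(D g * Ring.inverse g) := by
    rw [eq_neg_iff_add_eq_zero, add_comm]
    exact h1.symm
  have h3 := congrArg (fun t => Ring.inverse g * t) h2
  simp only [← mul_assoc, Ring.inverse_mul_cancel g hu, one_mul] at h3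
  rw [h3, mul_assoc _ _ (D g), H.even_mul hg.inverse (D g), mul_neg]

end IsSuperDer

/-! ## The derivative of the determinant -/

theorem Derivation.map_prod {A B N ι : Type*} [CommRing A] [CommRing B] [Algebra A B]
    [AddCommGroup N] [Module A N] [Module B N] [DecidableEq ι] (d : Derivation A B N)
    (s : Finset ι) (a : ι → B) :
    d (∏ i ∈ s, a i) = ∑ i ∈ s, (∏ j ∈ s.erase i, a j) • d (a i) := by
  induction s using Finset.induction_on with
  | empty => simp
  | insert i s hi ih =>
    rw [Finset.prod_insert hi, d.leibniz, ih, Finset.sum_insert hi, Finset.erase_insert hi,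
      add_comm, Finset.smul_sum]
    congr 1
    refine Finset.sum_congr rfl fun k hk => ?_
    have hik : i ≠ k := fun h => hi (h ▸ hk)
    rw [Finset.erase_insert_of_ne hik, Finset.prod_insert (fun h => hi (Finset.mem_of_mem_erase h)),
      smul_smul]

/-- Jacobi's formula. The values are in a module because it will be applied to determinants over the
commutative even part, which an odd derivation maps outside that part. -/
theorem Derivation.map_det {A B N n : Type*} [CommRing A] [CommRing B] [Algebra A B]
    [AddCommGroup N] [Module A N] [Module B N] [Fintype n] [DecidableEq n] (d : Derivation A B N)
    (M : Matrix n n B) : d M.det = ∑ i, ∑ k, M.adjugate k i • d (M i k) := by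
  -- The adjugate entry is the determinant with row `i` replaced by the `k`-th basis vector, so only
  -- permutations with `σ i = k` contribute.
  have hadj : ∀ i k, M.adjugate k i = ∑ σ : Equiv.Perm n, Equiv.Perm.sign σ •
      ((if σ i = k then 1 else 0) * ∏ j ∈ Finset.univ.erase i, M j (σ j)) := by
    intro i k
    rw [Matrix.adjugate_apply, ← Matrix.det_transpose, Matrix.det_apply]
    refine Finset.sum_congr rfl fun σ _ => ?_
    congr 1
    rw [← Finset.mul_prod_erase _ _ (Finset.mem_univ i)]
    congr 1
    · simp [Pi.single_apply]
    · refine Finset.prod_congr rfl fun j hj => ?_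
      simp [Finset.ne_of_mem_erase hj]
  simp_rw [hadj, Finset.sum_smul]
  rw [← Matrix.det_transpose, Matrix.det_apply, map_sum]
  have h : ∀ i, (∑ k, ∑ σ : Equiv.Perm n, (Equiv.Perm.sign σ •
      ((if σ i = k then 1 else 0) * ∏ j ∈ Finset.univ.erase i, M j (σ j))) • d (M i k)) =
      ∑ σ : Equiv.Perm n, Equiv.Perm.sign σ •
        ((∏ j ∈ Finset.univ.erase i, M j (σ j)) • d (M i (σ i))) := by
    intro i
    rw [Finset.sum_comm]
    refine Finset.sum_congr rfl fun σ _ => ?_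
    rw [Finset.sum_eq_single (σ i)]
    · simp [Units.smul_def, mul_smul, Int.cast_smul_eq_zsmul]
    · intro k _ hk
      simp [hk.symm]
    · simp
  simp_rw [h]
  rw [Finset.sum_comm]
  refine Finset.sum_congr rfl fun σ _ => ?_
  simp only [Matrix.transpose_apply, Units.smul_def, map_zsmul, d.map_prod, Finset.smul_sum]

/-! ## The derivative of the Berezinian -/

theorem ringDet_map {R S : Type*} [Ring R] [CommRing S] (φ : S →+* R) {n : ℕ}
    (A : Matrix (Fin n) (Fin n) S) : ringDet (A.map φ) = φ A.det := by
  rw [← Matrix.det_transpose, Matrix.det_apply, ringDet, map_sum]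
  refine Finset.sum_congr rfl fun σ _ => ?_
  rw [Units.smul_def, map_zsmul, ← List.prod_ofFn, map_list_prod, List.map_ofFn]
  rfl

/-- Via `φ` the ring `R` is an `S`-module and `D ∘ φ` is an ordinary derivation into it. Jacobi's
formula then applies, and the adjugate is the determinant times the inverse. -/
theorem map_ringDet_map {S : Type*} [CommRing S] [Algebra ℝ S] (φ : S →ₐ[ℝ] R) (D : R →ₗ[ℝ] R)
    (hφ : ∀ a r, φ a * r = r * φ a) (hD : ∀ a r, D (φ a * r) = D (φ a) * r + φ a * D r) {n : ℕ}
    (A : Matrix (Fin n) (Fin n) S) (hA : IsUnit A.det) :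
    D (ringDet (A.map φ)) =
      Matrix.trace (A⁻¹.map φ * (A.map φ).map D) * ringDet (A.map φ) := by
  let : Module S R := Module.compHom R φ.toRingHom
  have hsm : ∀ (a : S) (r : R), a • r = φ a * r := fun _ _ => rfl
  let d : Derivation ℝ S R :=
    { toLinearMap := D ∘ₗ φ.toLinearMap
      map_one_eq_zero' := by
        have := hD 1 1
        simpa using this
      leibniz' := fun a b => by
        change D (φ (a * b)) = φ a * D (φ b) + φ b * D (φ a)
        rw [map_mul, hD, hφ b, add_comm] }
  have h1 : D (φ A.det) = ∑ i, ∑ k, φ (A.adjugate k i) * D (φ (A i k)) := d.map_det A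
  have h2 : A.adjugate = A.det • A⁻¹ := by
    rw [Matrix.inv_def, smul_smul, Ring.mul_inverse_cancel _ hA, one_smul]
  have h3 : ringDet (A.map φ) = φ A.det := ringDet_map φ.toRingHom A
  rw [h3, h1, ← hφ, h2, Finset.sum_comm, Matrix.trace, Finset.mul_sum]
  refine Finset.sum_congr rfl fun k _ => ?_
  rw [Matrix.diag_apply, Matrix.mul_apply, Finset.mul_sum]
  refine Finset.sum_congr rfl fun i _ => ?_
  simp [mul_assoc]

variable (π) in
/-- The subalgebra of even elements. -/
def evenPart : Subalgebra ℝ R := AlgHom.equalizer π (AlgHom.id ℝ R)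

/-- The even part of a supercommutative algebra is commutative. -/
abbrev IsSuperComm.evenCommRing (H : IsSuperComm π) : CommRing (evenPart π) :=
  { (inferInstance : Ring (evenPart π)) with
    mul_comm := fun a b => Subtype.ext (H.even_mul (isHomog_zero_iff.2 a.2) b.1) }

/-- A matrix with even entries is a matrix over the commutative ring of even elements. The inverse
of an even unit is even, so invertibility of the determinant descends to that ring and ordinary
linear algebra applies. -/
theorem IsSuperComm.ringDet_props (H : IsSuperComm π) {n : ℕ} {A : Matrix (Fin n) (Fin n) R}
    (hA : ∀ a b, IsHomog π 0 (A a b)) :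
    IsHomog π 0 (ringDet A) ∧ (IsUnit (ringDet A) → IsUnit A ∧ ∀ i D, IsSuperDer π i D →
      D (ringDet A) = Matrix.trace (Ring.inverse A * A.map D) * ringDet A) := by
  let := H.evenCommRing
  let φ : evenPart π →ₐ[ℝ] R := (evenPart π).val
  have hφ : ∀ a r, φ a * r = r * φ a := fun a r => H.even_mul (isHomog_zero_iff.2 a.2) r
  let A₀ : Matrix (Fin n) (Fin n) (evenPart π) :=
    Matrix.of fun a b => ⟨A a b, isHomog_zero_iff.1 (hA a b)⟩
  have hA₀ : A₀.map φ = A := rfl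
  have hdet : ringDet A = φ A₀.det := ringDet_map φ.toRingHom A₀
  refine ⟨hdet ▸ isHomog_zero_iff.2 A₀.det.2, fun hu => ?_⟩
  have hu₀ : IsUnit A₀.det := by
    have h1 : IsHomog π 0 (Ring.inverse (ringDet A)) :=
      IsHomog.inverse (hdet ▸ isHomog_zero_iff.2 A₀.det.2)
    refine IsUnit.of_mul_eq_one ⟨_, isHomog_zero_iff.1 h1⟩ (Subtype.ext ?_)
    change φ A₀.det * Ring.inverse (ringDet A) = 1
    rw [← hdet, Ring.mul_inverse_cancel _ hu]
  have hinv : A₀⁻¹.map φ * A = 1 ∧ A * A₀⁻¹.map φ = 1 := by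
    constructor
    · have := congrArg (fun B => B.map φ) (Matrix.nonsing_inv_mul A₀ hu₀)
      simpa [Matrix.map_mul, hA₀] using this
    · have := congrArg (fun B => B.map φ) (Matrix.mul_nonsing_inv A₀ hu₀)
      simpa [Matrix.map_mul, hA₀] using this
  let U : (Matrix (Fin n) (Fin n) R)ˣ := ⟨A, A₀⁻¹.map φ, hinv.2, hinv.1⟩
  refine ⟨U.isUnit, fun i D hD => ?_⟩
  have hinv2 : Ring.inverse A = A₀⁻¹.map φ := Ring.inverse_unit U
  rw [hinv2]
  exact map_ringDet_map φ D hφ (fun a r => hD.leibniz_even (isHomog_zero_iff.2 a.2) r) A₀ hu₀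

/-! ### Supermatrices, graded traces and the logarithmic derivative of the Berezinian. -/

section Berezinian

open Matrix

variable {m n l : Type*} [Fintype n]

theorem IsSuperDer.map_matrix_mul (hD : IsSuperDer π i D) {P : Matrix m n R} {Q : Matrix n l R}
    (hP : ∀ a b, IsHomog π j (P a b)) :
    (P * Q).map D = P.map D * Q + paritySign (i * j) • (P * Q.map D) := by
  ext a b
  simp only [map_apply, mul_apply, map_sum, Matrix.add_apply, Matrix.smul_apply, Finset.smul_sum,
    ← Finset.sum_add_distrib]
  exact Finset.sum_congr rfl fun c _ => hD.leibniz j _ _ (hP a c)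

theorem IsHomog.matrix_mul {P : Matrix m n R} {Q : Matrix n l R}
    (hP : ∀ a b, IsHomog π i (P a b)) (hQ : ∀ a b, IsHomog π j (Q a b)) (a : m) (b : l) :
    IsHomog π (i + j) ((P * Q) a b) := by
  rw [mul_apply]
  exact IsHomog.sum fun c _ => (hP a c).mul (hQ c b)

/-- Graded cyclicity of the trace: each product of entries is swapped at the cost of the same sign.
It cancels the off-diagonal contributions to the derivative of the Berezinian. -/
theorem IsSuperComm.trace_mul_comm [Fintype m] (H : IsSuperComm π) {P : Matrix m n R} {Q : Matrix n m R}
    (hP : ∀ a b, IsHomog π i (P a b)) (hQ : ∀ a b, IsHomog π j (Q a b)) :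
    (P * Q).trace = paritySign (i * j) • (Q * P).trace := by
  simp only [trace, diag_apply, mul_apply, Finset.smul_sum]
  rw [Finset.sum_comm]
  exact Finset.sum_congr rfl fun b _ => Finset.sum_congr rfl fun a _ =>
    H.comm i j _ _ (hP a b) (hQ b a)

theorem IsSuperComm.trace_even_mul_comm [Fintype m] (H : IsSuperComm π) {P : Matrix m n R} {Q : Matrix n m R}
    (hP : ∀ a b, IsHomog π 0 (P a b)) : (P * Q).trace = (Q * P).trace := by
  simp only [trace, diag_apply, mul_apply]
  rw [Finset.sum_comm]
  exact Finset.sum_congr rfl fun b _ => Finset.sum_congr rfl fun a _ => H.even_mul (hP a b) _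

theorem IsHomog.matrix_inverse [DecidableEq n] {P : Matrix n n R}
    (hP : ∀ a b, IsHomog π 0 (P a b)) (a b : n) : IsHomog π 0 (Ring.inverse P a b) := by
  rw [isHomog_zero_iff]
  by_cases hu : IsUnit P
  · have h1 : Ring.inverse P * P = 1 := Ring.inverse_mul_cancel P hu
    have hP' : P.map π = P := ext fun a b => isHomog_zero_iff.1 (hP a b)
    have h2 : (Ring.inverse P).map π * P = 1 := by
      have := congrArg (fun B => B.map π) h1
      simpa [Matrix.map_mul, hP'] using this
    exact congrFun (congrFun (hu.mul_right_cancel (h2.trans h1.symm)) a) b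
  · simp [Ring.inverse_non_unit P hu]

variable {p q : ℕ} {J N K : Matrix (Fin p ⊕ Fin q) (Fin p ⊕ Fin q) R}

theorem isHomog_schur
    (hJ : ∀ a b, IsHomog π (coordParity a + coordParity b) (J a b)) (a b : Fin p) :
    IsHomog π 0 ((J.toBlocks₁₁ - J.toBlocks₁₂ * Ring.inverse J.toBlocks₂₂ * J.toBlocks₂₁) a b) := by
  have hB : ∀ a b, IsHomog π 1 (J.toBlocks₁₂ a b) := fun a b => hJ (Sum.inl a) (Sum.inr b)
  have hC : ∀ a b, IsHomog π 1 (J.toBlocks₂₁ a b) := fun a b => hJ (Sum.inr a) (Sum.inl b)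
  have hE : ∀ a b, IsHomog π 0 (Ring.inverse J.toBlocks₂₂ a b) :=
    IsHomog.matrix_inverse fun a b => hJ (Sum.inr a) (Sum.inr b)
  exact (hJ (Sum.inl a) (Sum.inl b)).sub
    (IsHomog.matrix_mul (fun a b => IsHomog.matrix_mul hB hE a b) hC a b)

theorem isHomog_berezinian (H : IsSuperComm π)
    (hJ : ∀ a b, IsHomog π (coordParity a + coordParity b) (J a b)) :
    IsHomog π 0 (berezinian J) :=
  (H.ringDet_props (isHomog_schur hJ)).1.mul
    (H.ringDet_props fun a b => hJ (Sum.inr a) (Sum.inr b)).1.inverse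

/-- The logarithmic derivative of the Berezinian along a vector field `D`, whose action on a Jacobi
matrix is described by the matrices `N` and `K` of derivatives of its components. -/
theorem IsSuperDer.map_berezinian (H : IsSuperComm π) (hD : IsSuperDer π i D)
    (hJ : ∀ a b, IsHomog π (coordParity a + coordParity b) (J a b))
    (hN : ∀ a b, IsHomog π (coordParity a + coordParity b + i) (N a b))
    (hK : ∀ a b, IsHomog π (coordParity a + coordParity b + i) (K a b))
    (hDJ : ∀ a b, D (J a b) = paritySign (i * coordParity a) • ((J * N) a b - (K * J) a b))
    (hu : IsUnit (berezinian J)) :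
    D (berezinian J) =
      (∑ a, paritySign (coordParity a * (i + 1)) • (N a a - K a a)) * berezinian J := by
  have hS := isHomog_schur hJ
  have hDd : ∀ a b, IsHomog π 0 (J.toBlocks₂₂ a b) := fun a b => hJ (Sum.inr a) (Sum.inr b)
  obtain ⟨hdS, hdS'⟩ := H.ringDet_props hS
  obtain ⟨hdD, hdD'⟩ := H.ringDet_props hDd
  have hu' := hu
  rw [berezinian, (H.commute hdS _).isUnit_mul_iff] at hu'
  have huD : IsUnit (ringDet J.toBlocks₂₂) := isUnit_ringInverse.1 hu'.2
  obtain ⟨hDu, hDd'⟩ := hdD' huD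
  obtain ⟨hSu, hSd'⟩ := hdS' hu'.1
  replace hDd' := hDd' i D hD
  replace hSd' := hSd' i D hD
  -- The Berezinian is a quotient of two even determinants, so its logarithmic derivative is the
  -- difference of theirs, for the Schur complement and for the odd-odd block.
  have hlog : D (berezinian J) =
      ((Ring.inverse (J.toBlocks₁₁ - J.toBlocks₁₂ * Ring.inverse J.toBlocks₂₂ * J.toBlocks₂₁) *
        (J.toBlocks₁₁ - J.toBlocks₁₂ * Ring.inverse J.toBlocks₂₂ * J.toBlocks₂₁).map D).trace -
      (Ring.inverse J.toBlocks₂₂ * J.toBlocks₂₂.map D).trace) * berezinian J := by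
    rw [berezinian, hD.leibniz_even hdS, hSd', hD.map_inverse H hdD huD, hDd', sub_mul, mul_assoc,
      mul_neg, ← sub_eq_add_neg]
    congr 1
    generalize (Ring.inverse J.toBlocks₂₂ * J.toBlocks₂₂.map D).trace = t
    have h1 := Ring.inverse_mul_cancel _ huD
    have hI := hdD.inverse
    generalize ringDet J.toBlocks₂₂ = d at *
    calc _ = ringDet _ * (Ring.inverse d * (Ring.inverse d * (t * d))) := by
          rw [mul_assoc (Ring.inverse d)]
      _ = ringDet _ * (Ring.inverse d * t) := by
          rw [← H.even_mul hdD t, ← mul_assoc (Ring.inverse d) d t, h1, one_mul]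
      _ = _ := by rw [← mul_assoc, H.even_mul (hdS.mul hI)]
  rw [hlog]
  congr 1
  -- The relation `D J = ±(J N - K J)` is read block by block; the sign `(-1)^i` appears only in the
  -- rows of odd index.
  have hXA : J.toBlocks₁₁.map D = J.toBlocks₁₁ * N.toBlocks₁₁ + J.toBlocks₁₂ * N.toBlocks₂₁ -
      K.toBlocks₁₁ * J.toBlocks₁₁ - K.toBlocks₁₂ * J.toBlocks₂₁ := by
    ext a b
    simp only [map_apply, toBlocks₁₁, of_apply, hDJ, mul_apply, Fintype.sum_sum_type, coordParity,
      Sum.elim_inl, mul_zero, paritySign_zero, one_smul, Matrix.sub_apply, Matrix.add_apply,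
      toBlocks₁₂, toBlocks₂₁]
    abel
  have hXB : J.toBlocks₁₂.map D = J.toBlocks₁₁ * N.toBlocks₁₂ + J.toBlocks₁₂ * N.toBlocks₂₂ -
      K.toBlocks₁₁ * J.toBlocks₁₂ - K.toBlocks₁₂ * J.toBlocks₂₂ := by
    ext a b
    simp only [map_apply, toBlocks₁₁, of_apply, hDJ, mul_apply, Fintype.sum_sum_type, coordParity,
      Sum.elim_inl, mul_zero, paritySign_zero, one_smul, Matrix.sub_apply, Matrix.add_apply,
      toBlocks₁₂, toBlocks₂₂]
    abel
  have hXC : J.toBlocks₂₁.map D = paritySign i • (J.toBlocks₂₁ * N.toBlocks₁₁ +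
      J.toBlocks₂₂ * N.toBlocks₂₁ - K.toBlocks₂₁ * J.toBlocks₁₁ -
      K.toBlocks₂₂ * J.toBlocks₂₁) := by
    ext a b
    simp only [map_apply, toBlocks₁₁, of_apply, hDJ, mul_apply, Fintype.sum_sum_type, coordParity,
      Sum.elim_inr, mul_one, Matrix.sub_apply, Matrix.add_apply, Matrix.smul_apply,
      toBlocks₂₁, toBlocks₂₂]
    congr 1
    abel
  have hXD : J.toBlocks₂₂.map D = paritySign i • (J.toBlocks₂₁ * N.toBlocks₁₂ +
      J.toBlocks₂₂ * N.toBlocks₂₂ - K.toBlocks₂₁ * J.toBlocks₁₂ -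
      K.toBlocks₂₂ * J.toBlocks₂₂) := by
    ext a b
    simp only [map_apply, toBlocks₁₂, of_apply, hDJ, mul_apply, Fintype.sum_sum_type, coordParity,
      Sum.elim_inr, mul_one, Matrix.sub_apply, Matrix.add_apply, Matrix.smul_apply,
      toBlocks₂₁, toBlocks₂₂]
    congr 1
    abel
  have hB : ∀ a b, IsHomog π 1 (J.toBlocks₁₂ a b) := fun a b => hJ (Sum.inl a) (Sum.inr b)
  have hC : ∀ a b, IsHomog π 1 (J.toBlocks₂₁ a b) := fun a b => hJ (Sum.inr a) (Sum.inl b)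
  have hE : ∀ a b, IsHomog π 0 (Ring.inverse J.toBlocks₂₂ a b) := IsHomog.matrix_inverse hDd
  have hN12 : ∀ a b, IsHomog π (1 + i) (N.toBlocks₁₂ a b) := fun a b => by
    simpa [coordParity, toBlocks₁₂] using hN (Sum.inl a) (Sum.inr b)
  have hK21 : ∀ a b, IsHomog π (1 + i) (K.toBlocks₂₁ a b) := fun a b => by
    simpa [coordParity, toBlocks₂₁] using hK (Sum.inr a) (Sum.inl b)
  -- The claimed factor is the supertrace of `N - K` for matrices of parity `i`.
  have hsum : (∑ a, paritySign (coordParity a * (i + 1)) • (N a a - K a a)) =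
      (N.toBlocks₁₁.trace - K.toBlocks₁₁.trace) -
        paritySign i • (N.toBlocks₂₂.trace - K.toBlocks₂₂.trace) := by
    simp only [Fintype.sum_sum_type, coordParity, Sum.elim_inl, Sum.elim_inr, zero_mul, one_mul,
      paritySign_zero, one_smul, trace, diag_apply, toBlocks₁₁, toBlocks₂₂, of_apply,
      ← Finset.sum_sub_distrib, Finset.smul_sum, paritySign_add, paritySign_one, mul_neg, mul_one,
      neg_smul, Finset.sum_neg_distrib]
    rw [sub_eq_add_neg]
  rw [hsum]
  clear hsum hlog hDJ hN hK hSd' hDd' hu hu' hdD' hdS'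
  generalize J.toBlocks₁₁ = A at *
  generalize J.toBlocks₁₂ = B at *
  generalize J.toBlocks₂₁ = C at *
  generalize J.toBlocks₂₂ = Δ at *
  generalize N.toBlocks₁₁ = N₁₁ at *
  generalize N.toBlocks₁₂ = N₁₂ at *
  generalize N.toBlocks₂₁ = N₂₁ at *
  generalize N.toBlocks₂₂ = N₂₂ at *
  generalize K.toBlocks₁₁ = K₁₁ at *
  generalize K.toBlocks₁₂ = K₁₂ at *
  generalize K.toBlocks₂₁ = K₂₁ at *
  generalize K.toBlocks₂₂ = K₂₂ at *
  have hΔE := Ring.mul_inverse_cancel Δ hDu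
  have hEΔ := Ring.inverse_mul_cancel Δ hDu
  generalize Ring.inverse Δ = E at *
  -- The derivative of an inverse, from differentiating `Δ E = 1`.
  have hXE : E.map D = -(E * Δ.map D * E) := by
    have h1 := hD.map_matrix_mul (P := Δ) (Q := E) hDd
    have h2 : (1 : Matrix (Fin q) (Fin q) R).map D = 0 := by
      ext a b
      rcases eq_or_ne a b with rfl | hab
      · simp [hD.map_one]
      · simp [hab]
    rw [hΔE, h2, mul_zero, paritySign_zero, one_smul] at h1
    have h3 := congrArg (fun Z => E * Z) (eq_neg_of_add_eq_zero_right h1.symm)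
    simp only [← mul_assoc, hEΔ, one_mul] at h3
    rw [h3, mul_neg, mul_assoc]
  have c1 : ∀ {l : Type} (Z : Matrix (Fin q) l R), Δ * (E * Z) = Z := fun Z => by
    rw [← Matrix.mul_assoc, hΔE, Matrix.one_mul]
  have c2 : ∀ {l : Type} (Z : Matrix (Fin q) l R), E * (Δ * Z) = Z := fun Z => by
    rw [← Matrix.mul_assoc, hEΔ, Matrix.one_mul]
  -- With `S` the Schur complement, `D S = S (N₁₁ - N₁₂ E C) - (K₁₁ - B E K₂₁) S`. The sign from
  -- moving `D` past the odd block `B` cancels the sign of the odd rows, and the other blocks of `N`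
  -- and `K` drop out.
  have hXS : (A - B * E * C).map D = (A - B * E * C) * N₁₁ - (A - B * E * C) * (N₁₂ * (E * C)) -
      K₁₁ * (A - B * E * C) + B * E * K₂₁ * (A - B * E * C) := by
    have h1 : (A - B * E * C).map D = A.map D - (B * E * C).map D := by
      ext a b
      simp
    rw [h1, hD.map_matrix_mul (IsHomog.matrix_mul hB hE), hD.map_matrix_mul hB, hXE, hXA, hXB, hXC,
      hXD, add_zero, mul_one]
    simp only [Matrix.mul_add, Matrix.add_mul, Matrix.mul_sub, Matrix.sub_mul, Matrix.mul_assoc,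
      Matrix.mul_neg, Matrix.neg_mul, Matrix.smul_mul, Matrix.mul_smul, smul_add, smul_sub,
      smul_neg, paritySign_smul_smul, c1, c2]
    abel
  have hT := IsHomog.matrix_inverse hS
  have hST := Ring.inverse_mul_cancel _ hSu
  have hTS := Ring.mul_inverse_cancel _ hSu
  generalize A - B * E * C = S at *
  generalize Ring.inverse S = T at *
  have t1 : (T * S.map D).trace =
      N₁₁.trace - (N₁₂ * (E * C)).trace - K₁₁.trace + (B * E * K₂₁).trace := by
    rw [hXS, Matrix.mul_add, Matrix.mul_sub, Matrix.mul_sub, trace_add, trace_sub, trace_sub,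
      ← Matrix.mul_assoc T S, ← Matrix.mul_assoc T S, hST, Matrix.one_mul, Matrix.one_mul,
      H.trace_even_mul_comm hT (Q := K₁₁ * S), H.trace_even_mul_comm hT (Q := B * E * K₂₁ * S),
      Matrix.mul_assoc K₁₁, hTS, Matrix.mul_one, Matrix.mul_assoc _ S, hTS, Matrix.mul_one]
  have t2 : (E * Δ.map D).trace = paritySign i • ((E * C * N₁₂).trace + N₂₂.trace -
      (E * (K₂₁ * B)).trace - K₂₂.trace) := by
    rw [hXD, Matrix.mul_smul, trace_smul, Matrix.mul_sub, Matrix.mul_sub, Matrix.mul_add, trace_sub,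
      trace_sub, trace_add, ← Matrix.mul_assoc E Δ, hEΔ, Matrix.one_mul,
      H.trace_even_mul_comm hE (Q := K₂₂ * Δ), Matrix.mul_assoc K₂₂, hΔE, Matrix.mul_one,
      ← Matrix.mul_assoc E C]
  -- Here `N₁₂` has parity `1 + i` and `E C` is odd. This trace and the one in `t4` cancel their
  -- counterparts from the derivative of `det Δ`, leaving only diagonal blocks.
  have t3 : (N₁₂ * (E * C)).trace = -(paritySign i • (E * C * N₁₂).trace) := by
    rw [H.trace_mul_comm hN12 (IsHomog.matrix_mul hE hC)]
    simp [paritySign_add]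
  have t4 : (B * E * K₂₁).trace = -(paritySign i • (E * (K₂₁ * B)).trace) := by
    rw [Matrix.mul_assoc, H.trace_mul_comm hB (IsHomog.matrix_mul hE hK21), Matrix.mul_assoc]
    simp [paritySign_add]
  rw [t1, t2, t3, t4]
  simp only [smul_add, smul_sub]
  abel

end Berezinian

end SuperAlgebra

/-! ## The exterior algebra: contractions are odd derivations -/

namespace ExteriorAlgebra

variable {R V : Type*} [CommRing R] [AddCommGroup V] [Module R V] (d : V →ₗ[R] R)

theorem involute_contractLeft (a : ExteriorAlgebra R V) :
    CliffordAlgebra.involute (CliffordAlgebra.contractLeft (Q := (0 : QuadraticForm R V)) d a) =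
      -CliffordAlgebra.contractLeft (Q := (0 : QuadraticForm R V)) d
        (CliffordAlgebra.involute a) := by
  induction a using CliffordAlgebra.left_induction with
  | algebraMap r => simp
  | add a b ha hb => simp only [map_add, ha, hb, neg_add]
  | ι_mul a v ha =>
    rw [CliffordAlgebra.contractLeft_ι_mul, map_sub, map_smul, map_mul, map_mul, ha,
      CliffordAlgebra.involute_ι, neg_mul, neg_mul, map_neg, CliffordAlgebra.contractLeft_ι_mul]
    simp

theorem contractLeft_mul (a b : ExteriorAlgebra R V) :
    CliffordAlgebra.contractLeft (Q := (0 : QuadraticForm R V)) d (a * b) =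
      CliffordAlgebra.contractLeft (Q := (0 : QuadraticForm R V)) d a * b +
        CliffordAlgebra.involute a *
          CliffordAlgebra.contractLeft (Q := (0 : QuadraticForm R V)) d b := by
  induction a using CliffordAlgebra.left_induction with
  | algebraMap r => simp [CliffordAlgebra.contractLeft_algebraMap_mul]
  | add a c ha hc => simp only [map_add, add_mul, ha, hc]; abel
  | ι_mul a v ha =>
    rw [mul_assoc, CliffordAlgebra.contractLeft_ι_mul, ha, CliffordAlgebra.contractLeft_ι_mul,
      map_mul, CliffordAlgebra.involute_ι]
    simp only [mul_add, sub_mul, smul_mul_assoc, neg_mul, mul_assoc]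
    abel

end ExteriorAlgebra

/-! ## Calculus on superdomains -/

namespace SmoothFun

variable {p : ℕ} {V V' : Opens (EuclideanSpace ℝ (Fin p))}

theorem differentiableAt_extendZero (f : SmoothFun V) (x : V) : DifferentiableAt ℝ (extendZero f.1) x.1 :=
  (f.2.contDiffAt (V.2.mem_nhds x.2)).differentiableAt (by simp)

theorem pderiv_apply (i : Fin p) (f : SmoothFun V) (x : V) :
    (pderiv V i f).1 x = fderiv ℝ (extendZero f.1) x.1 (EuclideanSpace.single i 1) := rfl

theorem pderiv_mul (i : Fin p) (f g : SmoothFun V) :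
    pderiv V i (f * g) = pderiv V i f * g + f * pderiv V i g := by
  ext x
  have h : extendZero (f * g).1 =ᶠ[nhds x.1] extendZero f.1 * extendZero g.1 := by
    filter_upwards [V.2.mem_nhds x.2] with y hy
    simp [extendZero_apply _ (show y ∈ V from hy)]
  change (pderiv V i (f * g)).1 x = (pderiv V i f).1 x * g.1 x + f.1 x * (pderiv V i g).1 x
  rw [pderiv_apply, h.fderiv_eq, fderiv_mul (differentiableAt_extendZero f x) (differentiableAt_extendZero g x),
    extendZero_apply _ x.2, extendZero_apply _ x.2, pderiv_apply, pderiv_apply]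
  simp
  ring

theorem pderiv_coord (i j : Fin p) :
    pderiv V i (coord V j) = if i = j then 1 else 0 := by
  ext x
  have h : extendZero (coord V j).1 =ᶠ[nhds x.1] fun y => EuclideanSpace.proj (𝕜 := ℝ) j y := by
    filter_upwards [V.2.mem_nhds x.2] with y hy
    rw [extendZero_apply _ (show y ∈ V from hy)]
    rfl
  rw [pderiv_apply, h.fderiv_eq, ContinuousLinearMap.fderiv]
  by_cases hij : i = j
  · subst hij
    simp
  · simp [hij, Ne.symm hij]

theorem restrict_pderiv (h : V' ≤ V) (i : Fin p) (f : SmoothFun V) :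
    restrict h (pderiv V i f) = pderiv V' i (restrict h f) := by
  ext x
  have he : extendZero (restrict h f).1 =ᶠ[nhds x.1] extendZero f.1 := by
    filter_upwards [V'.2.mem_nhds x.2] with y hy
    rw [extendZero_apply _ (show y ∈ V' from hy), extendZero_apply _ (h hy)]
    rfl
  rw [pderiv_apply, he.fderiv_eq]
  rfl

theorem absPowDiv_apply {b : SmoothFun V} (hb : ∀ x, b.1 x ≠ 0) (w : ℝ) (k : ℕ) (x : V) :
    (absPowDiv b w k).1 x = |b.1 x| ^ w / b.1 x ^ k := by
  rw [absPowDiv, dif_pos hb]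

/-- Together with `pderiv_absPowDiv`, this is all that the binomial series needs to know about its
coefficients `|b|^w b^{-k}`. -/
theorem mul_absPowDiv_succ {b : SmoothFun V} (hb : ∀ x, b.1 x ≠ 0) (w : ℝ) (k : ℕ) :
    b * absPowDiv b w (k + 1) = absPowDiv b w k := by
  ext x
  change b.1 x * (absPowDiv b w (k + 1)).1 x = _
  rw [absPowDiv_apply hb, absPowDiv_apply hb]
  have := hb x
  field_simp
  ring

theorem restrict_absPowDiv (h : V' ≤ V) {b : SmoothFun V} (hb : ∀ x, b.1 x ≠ 0) (w : ℝ) (k : ℕ) :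
    restrict h (absPowDiv b w k) = absPowDiv (restrict h b) w k := by
  ext x
  rw [absPowDiv_apply (fun x => hb ⟨x.1, h x.2⟩)]
  change (absPowDiv b w k).1 ⟨x.1, h x.2⟩ = _
  rw [absPowDiv_apply hb]
  rfl

/-- Written as `w |t|^w / t`, the derivative of `|t|^w` has the same form for both signs of `t`. -/
theorem hasDerivAt_abs_rpow_div_pow {t : ℝ} (ht : t ≠ 0) (w : ℝ) (k : ℕ) :
    HasDerivAt (fun t : ℝ => |t| ^ w / t ^ k) ((w - k) * (|t| ^ w / t ^ (k + 1))) t := by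
  have h1 : HasDerivAt (fun t : ℝ => |t| ^ w) (w * (|t| ^ w / t)) t := by
    rcases lt_or_gt_of_ne ht with h | h
    · have h2 : HasDerivAt (fun t : ℝ => (-t) ^ w) (w * (|t| ^ w / t)) t := by
        have h3 := (hasDerivAt_neg t).rpow_const (p := w) (Or.inl (by simpa using ht))
        refine h3.congr_deriv ?_
        rw [abs_of_neg h, Real.rpow_sub_one (by simpa using ht)]
        field_simp
      refine h2.congr_of_eventuallyEq ?_
      filter_upwards [eventually_lt_nhds h] with s hs
      rw [abs_of_neg hs]
    · have h2 : HasDerivAt (fun t : ℝ => t ^ w) (w * (|t| ^ w / t)) t := by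
        have h3 := (hasDerivAt_id t).rpow_const (p := w) (Or.inl ht)
        refine h3.congr_deriv ?_
        rw [abs_of_pos h, id, Real.rpow_sub_one ht]
        field_simp
      refine h2.congr_of_eventuallyEq ?_
      filter_upwards [eventually_gt_nhds h] with s hs
      rw [abs_of_pos hs]
  refine (h1.div (hasDerivAt_pow k t) (pow_ne_zero k ht)).congr_deriv ?_
  rcases k with _ | k
  · simp
  · rw [Nat.add_sub_cancel]
    field_simp
    push_cast
    ring

theorem pderiv_absPowDiv {b : SmoothFun V} (hb : ∀ x, b.1 x ≠ 0) (w : ℝ) (k : ℕ) (i : Fin p) :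
    pderiv V i (absPowDiv b w k) =
      (w - k) • (absPowDiv b w (k + 1) * pderiv V i b) := by
  ext x
  have hx : extendZero b.1 x.1 = b.1 x := extendZero_apply _ x.2
  have h : extendZero (absPowDiv b w k).1 =ᶠ[nhds x.1]
      (fun t : ℝ => |t| ^ w / t ^ k) ∘ extendZero b.1 := by
    filter_upwards [V.2.mem_nhds x.2] with y hy
    rw [extendZero_apply _ (show y ∈ V from hy), absPowDiv_apply hb, Function.comp,
      extendZero_apply _ (show y ∈ V from hy)]
  have h2 := (hasDerivAt_abs_rpow_div_pow (hx ▸ hb x) w k).comp_hasFDerivAt x.1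
    (differentiableAt_extendZero b x).hasFDerivAt
  change (pderiv V i (absPowDiv b w k)).1 x =
    (w - k) * ((absPowDiv b w (k + 1)).1 x * (pderiv V i b).1 x)
  rw [pderiv_apply, h.fderiv_eq, h2.fderiv, absPowDiv_apply hb, pderiv_apply, hx]
  simp [mul_assoc]

end SmoothFun

namespace SuperFun

variable {p q : ℕ} {V V' : Opens (EuclideanSpace ℝ (Fin p))}

noncomputable instance instRing : Ring (SuperFun q V) := Algebra.TensorProduct.instRing

noncomputable instance instAlgebra : Algebra ℝ (SuperFun q V) := Algebra.TensorProduct.instAlgebra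

noncomputable instance instMul : Mul (SuperFun q V) := instRing.toMul

/-- The value in the exterior algebra at a point of the underlying open set. -/
noncomputable def eval (x : V) : SuperFun q V →ₐ[ℝ] ExteriorAlgebra ℝ (Fin q → ℝ) :=
  Algebra.TensorProduct.lift
    ((Algebra.ofId ℝ _).comp ((Pi.evalAlgHom ℝ (fun _ : V => ℝ) x).comp (SmoothFun V).val))
    (AlgHom.id ℝ _) fun f a => Algebra.commutes (f.1 x) a

theorem eval_tmul (x : V) (f : SmoothFun V) (a : ExteriorAlgebra ℝ (Fin q → ℝ)) :
    eval x (f ⊗ₜ[ℝ] a) = f.1 x • a := by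
  rw [Algebra.smul_def]
  exact Algebra.TensorProduct.lift_tmul _ _ _ _ _

/-- In a basis of the exterior algebra, an element of the tensor product is a finite family of
smooth functions, and evaluation computes their values. Identities on superdomains thereby reduce to
identities in the exterior algebra. -/
theorem ext_eval {z z' : SuperFun q V} (h : ∀ x, eval x z = eval x z') : z = z' := by
  classical
  let b := Module.Basis.ofVectorSpace ℝ (ExteriorAlgebra ℝ (Fin q → ℝ))
  have key : ∀ (z : SuperFun q V) (x : V) i,
      b.repr (eval x z) i = (TensorProduct.equivFinsuppOfBasisRight b z i).1 x := by
    intro z x i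
    induction z using TensorProduct.induction_on with
    | zero => simp
    | tmul f a =>
      rw [eval_tmul, TensorProduct.equivFinsuppOfBasisRight_apply_tmul_apply]
      simp [mul_comm]
    | add z z' hz hz' => simp [hz, hz']
  apply (TensorProduct.equivFinsuppOfBasisRight b).injective
  ext i x
  rw [← key, ← key, h]

theorem body_tmul (f : SmoothFun V) (a : ExteriorAlgebra ℝ (Fin q → ℝ)) :
    body (f ⊗ₜ[ℝ] a) = ExteriorAlgebra.algebraMapInv a • f := by
  simp [body]

theorem body_tmul_one (f : SmoothFun V) : body (q := q) (f ⊗ₜ[ℝ] 1) = f := by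
  rw [body_tmul, map_one, one_smul]

theorem algebraMapInv_eval (x : V) (z : SuperFun q V) :
    ExteriorAlgebra.algebraMapInv (eval x z) = (body z).1 x := by
  induction z using TensorProduct.induction_on with
  | zero => simp
  | tmul f a => rw [eval_tmul, body_tmul, map_smul]; simp [mul_comm]
  | add z z' hz hz' => simp [hz, hz']

theorem eval_parity (x : V) (z : SuperFun q V) :
    eval x (parity q V z) = CliffordAlgebra.involute (eval x z) := by
  induction z using TensorProduct.induction_on with
  | zero => simp
  | tmul f a =>
    rw [eval_tmul, map_smul, parity, Algebra.TensorProduct.map_tmul, eval_tmul]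
    rfl
  | add z z' hz hz' => rw [map_add, map_add, hz, hz', map_add, map_add]

theorem eval_restrict (h : V' ≤ V) (x : V') (z : SuperFun q V) :
    eval x (restrict q h z) = eval ⟨x.1, h x.2⟩ z := by
  induction z using TensorProduct.induction_on with
  | zero => simp
  | tmul f a =>
    rw [eval_tmul, restrict, Algebra.TensorProduct.map_tmul, eval_tmul]
    rfl
  | add z z' hz hz' => rw [map_add, map_add, hz, hz', map_add]

theorem eval_pderiv_inr (x : V) (j : Fin q) (z : SuperFun q V) :
    eval x (pderiv q V (Sum.inr j) z) =
      CliffordAlgebra.contractLeft (Q := (0 : QuadraticForm ℝ (Fin q → ℝ)))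
        (LinearMap.proj j : (Fin q → ℝ) →ₗ[ℝ] ℝ) (eval x z) := by
  induction z using TensorProduct.induction_on with
  | zero => simp
  | tmul f a =>
    rw [eval_tmul, map_smul]
    exact eval_tmul x f _
  | add z z' hz hz' => rw [map_add, map_add, hz, hz', map_add, map_add]

theorem isSuperComm : IsSuperComm (parity q V) where
  invol z := ext_eval fun x => by
    rw [eval_parity, eval_parity, CliffordAlgebra.involute_involute]
  comm i j f g hf hg := ext_eval fun x => by
    have hf' := congrArg (eval x) hf
    have hg' := congrArg (eval x) hg
    rw [eval_parity, map_smul] at hf' hg'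
    rw [map_smul, map_mul, map_mul]
    rcases ZMod.two_cases j with rfl | rfl
    · rw [paritySign_zero, one_smul] at hg'
      rw [ExteriorAlgebra.mul_comm_of_involute_eq hg']
      simp
    · rw [paritySign_one, neg_one_smul] at hg'
      rw [ExteriorAlgebra.mul_eq_mul_involute_of_involute_eq_neg hg', hf']
      simp

theorem isHomog_tmul_one (f : SmoothFun V) : IsHomog (parity q V) 0 (f ⊗ₜ[ℝ] 1) := by
  rw [isHomog_zero_iff, parity, Algebra.TensorProduct.map_tmul, map_one]
  rfl

theorem isHomog_one_tmul_ι (v : Fin q → ℝ) :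
    IsHomog (parity q V) 1 ((1 : SmoothFun V) ⊗ₜ[ℝ] ExteriorAlgebra.ι ℝ v) := by
  refine ext_eval fun x => ?_
  rw [eval_parity, map_smul, eval_tmul, map_smul]
  have : CliffordAlgebra.involute (ExteriorAlgebra.ι ℝ v) = -ExteriorAlgebra.ι ℝ v :=
    CliffordAlgebra.involute_ι v
  rw [this]
  simp

theorem isHomog_coord (a : Fin p ⊕ Fin q) : IsHomog (parity q V) (coordParity a) (coord q V a) := by
  rcases a with i | j
  · exact isHomog_tmul_one _
  · exact isHomog_one_tmul_ι _

theorem pderiv_inl_tmul (i : Fin p) (f : SmoothFun V) (a : ExteriorAlgebra ℝ (Fin q → ℝ)) :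
    pderiv q V (Sum.inl i) (f ⊗ₜ[ℝ] a) = SmoothFun.pderiv V i f ⊗ₜ[ℝ] a := rfl

theorem pderiv_inl_mul (i : Fin p) (f g : SuperFun q V) :
    pderiv q V (Sum.inl i) (f * g) =
      pderiv q V (Sum.inl i) f * g + f * pderiv q V (Sum.inl i) g := by
  induction f using TensorProduct.induction_on with
  | zero => simp
  | add f f' hf hf' => rw [add_mul, map_add, hf, hf', map_add, add_mul, add_mul]; abel
  | tmul f a =>
    induction g using TensorProduct.induction_on with
    | zero => simp
    | add g g' hg hg' => rw [mul_add, map_add, hg, hg', map_add, mul_add, mul_add]; abel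
    | tmul g b =>
      simp only [Algebra.TensorProduct.tmul_mul_tmul, pderiv_inl_tmul, SmoothFun.pderiv_mul,
        TensorProduct.add_tmul]

theorem parity_pderiv_inl (i : Fin p) (f : SuperFun q V) :
    parity q V (pderiv q V (Sum.inl i) f) = pderiv q V (Sum.inl i) (parity q V f) := by
  induction f using TensorProduct.induction_on with
  | zero => simp
  | add f f' hf hf' => rw [map_add, map_add, hf, hf', map_add, map_add]
  | tmul f a => rfl

theorem isSuperDer_pderiv (a : Fin p ⊕ Fin q) :
    IsSuperDer (parity q V) (coordParity a) (pderiv q V a) := by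
  rcases a with i | l
  · refine ⟨fun j g hg => ?_, fun j g h _ => ?_⟩
    · change parity q V _ = _
      rw [parity_pderiv_inl, hg, map_smul]
      simp [coordParity]
    · rw [pderiv_inl_mul]
      simp [coordParity]
  · refine ⟨fun j g hg => ext_eval fun x => ?_, fun j g h hg => ext_eval fun x => ?_⟩
    · have hg' := congrArg (eval x) hg
      rw [eval_parity, map_smul] at hg'
      rw [eval_parity, eval_pderiv_inr, ExteriorAlgebra.involute_contractLeft, hg', map_smul,
        map_smul, eval_pderiv_inr]
      simp [coordParity, paritySign_add]
    · have hg' := congrArg (eval x) hg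
      rw [eval_parity, map_smul] at hg'
      rw [eval_pderiv_inr, map_mul, ExteriorAlgebra.contractLeft_mul, hg', map_add, map_smul,
        map_mul, map_mul, eval_pderiv_inr, eval_pderiv_inr]
      simp [coordParity]

theorem pderiv_coord (a b : Fin p ⊕ Fin q) :
    pderiv q V a (coord q V b) = if a = b then 1 else 0 := by
  rcases a with i | i <;> rcases b with j | j
  · change SmoothFun.pderiv V i (SmoothFun.coord V j) ⊗ₜ[ℝ] 1 = _
    rw [SmoothFun.pderiv_coord]
    by_cases h : i = j
    · simp [h, Algebra.TensorProduct.one_def]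
    · simp [h]
  · change SmoothFun.pderiv V i 1 ⊗ₜ[ℝ] _ = _
    have h : SmoothFun.pderiv V i 1 = 0 := by
      have h1 := SmoothFun.pderiv_mul (V := V) i 1 1
      rw [mul_one, mul_one, one_mul] at h1
      exact left_eq_add.1 h1
    rw [h, TensorProduct.zero_tmul, if_neg (by simp)]
  · refine ext_eval fun x => ?_
    rw [eval_pderiv_inr]
    have h : eval x (coord q V (Sum.inl j)) = algebraMap ℝ _ (x.1 j) := by
      rw [Algebra.algebraMap_eq_smul_one]
      exact eval_tmul x _ _
    rw [h, CliffordAlgebra.contractLeft_algebraMap]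
    simp
  · refine ext_eval fun x => ?_
    rw [eval_pderiv_inr]
    have h : eval x (coord q V (Sum.inr j)) = ExteriorAlgebra.ι ℝ (Pi.single j 1) := by
      exact (eval_tmul x (1 : SmoothFun V) _).trans (one_smul _ _)
    rw [h, CliffordAlgebra.contractLeft_ι]
    by_cases hij : i = j
    · simp [hij]
    · simp [hij]

theorem restrict_tmul (h : V' ≤ V) (f : SmoothFun V) (a : ExteriorAlgebra ℝ (Fin q → ℝ)) :
    restrict q h (f ⊗ₜ[ℝ] a) = SmoothFun.restrict h f ⊗ₜ[ℝ] a := by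
  simp [restrict]

theorem restrict_pderiv (h : V' ≤ V) (a : Fin p ⊕ Fin q) (f : SuperFun q V) :
    restrict q h (pderiv q V a f) = pderiv q V' a (restrict q h f) := by
  rcases a with i | j
  · induction f using TensorProduct.induction_on with
    | zero => simp
    | add f f' hf hf' => simp only [map_add, hf, hf']
    | tmul f a =>
      rw [pderiv_inl_tmul, restrict_tmul, restrict_tmul, pderiv_inl_tmul,
        SmoothFun.restrict_pderiv]
  · refine ext_eval fun x => ?_
    rw [eval_restrict, eval_pderiv_inr, eval_pderiv_inr, eval_restrict]

theorem restrict_coord (h : V' ≤ V) (a : Fin p ⊕ Fin q) :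
    restrict q h (coord q V a) = coord q V' a := by
  rcases a with i | j
  · exact restrict_tmul h _ _
  · exact restrict_tmul h _ _

theorem body_restrict (h : V' ≤ V) (f : SuperFun q V) :
    body (restrict q h f) = SmoothFun.restrict h (body f) := by
  ext x
  rw [← algebraMapInv_eval, eval_restrict, algebraMapInv_eval]
  rfl

/-- A derivation that kills the coordinates vanishes. -/
theorem superDer_eq_zero {i : ZMod 2} {D : SuperFun q V →ₗ[ℝ] SuperFun q V}
    (hD : IsSuperDer (parity q V) i D) (h : ∀ a, D (coord q V a) = 0) : D = 0 := by
  have h1 : ∀ f : SmoothFun V, D (f ⊗ₜ[ℝ] 1) = 0 := fun f => ext_eval fun x => by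
    rw [map_zero]
    -- On functions of the even variables, `D` followed by evaluation at `x` is a point derivation,
    -- to which Hadamard's argument applies.
    let δ : SmoothFun V →ₗ[ℝ] ExteriorAlgebra ℝ (Fin q → ℝ) :=
      (eval x).toLinearMap ∘ₗ D ∘ₗ (Algebra.TensorProduct.includeLeft :
        SmoothFun V →ₐ[ℝ] SuperFun q V).toLinearMap
    refine SmoothFun.pointDerivation_eq_zero x δ (fun f g => ?_) (fun l => ?_) f
    · change eval x (D ((f * g) ⊗ₜ[ℝ] 1)) =
        f.1 x • eval x (D (g ⊗ₜ[ℝ] 1)) + g.1 x • eval x (D (f ⊗ₜ[ℝ] 1))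
      have h2 : ((f * g) ⊗ₜ[ℝ] 1 : SuperFun q V) = (f ⊗ₜ[ℝ] 1) * (g ⊗ₜ[ℝ] 1) := by simp
      rw [h2, hD.leibniz_even (isHomog_tmul_one f), map_add, map_mul, map_mul, eval_tmul,
        eval_tmul, mul_smul_comm, mul_one, smul_mul_assoc, one_mul, add_comm]
    · change eval x (D (coord q V (Sum.inl l))) = 0
      rw [h, map_zero]
  -- The odd variables are algebraic generators, so the Leibniz rule alone suffices here.
  have h2 : ∀ a : ExteriorAlgebra ℝ (Fin q → ℝ), D ((1 : SmoothFun V) ⊗ₜ[ℝ] a) = 0 := fun a => by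
    induction a using CliffordAlgebra.left_induction with
    | algebraMap r =>
      have : ((1 : SmoothFun V) ⊗ₜ[ℝ] algebraMap ℝ (ExteriorAlgebra ℝ (Fin q → ℝ)) r) =
          algebraMap ℝ (SuperFun q V) r := by
        rw [Algebra.algebraMap_eq_smul_one, Algebra.algebraMap_eq_smul_one,
          TensorProduct.tmul_smul, Algebra.TensorProduct.one_def]
      exact (congrArg D this).trans (hD.map_algebraMap r)
    | add a b ha hb => rw [TensorProduct.tmul_add, map_add, ha, hb, add_zero]
    | ι_mul a v ha =>
      have h3 : ((1 : SmoothFun V) ⊗ₜ[ℝ] (ExteriorAlgebra.ι ℝ v * a)) =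
          ((1 : SmoothFun V) ⊗ₜ[ℝ] ExteriorAlgebra.ι ℝ v) * ((1 : SmoothFun V) ⊗ₜ[ℝ] a) := by simp
      have h4 : D ((1 : SmoothFun V) ⊗ₜ[ℝ] ExteriorAlgebra.ι ℝ v) = 0 := by
        have hv : v = ∑ j, v j • Pi.single j (1 : ℝ) := by
          ext k
          simp [Pi.single_apply]
        rw [hv, map_sum, TensorProduct.tmul_sum, map_sum]
        refine Finset.sum_eq_zero fun j _ => ?_
        rw [map_smul, TensorProduct.tmul_smul, map_smul]
        exact (congrArg (fun t => v j • t) (h (Sum.inr j))).trans (smul_zero _)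
      change D ((1 : SmoothFun V) ⊗ₜ[ℝ] (ExteriorAlgebra.ι ℝ v * a)) = 0
      rw [h3, hD.leibniz 1 _ _ (isHomog_one_tmul_ι v), h4, ha, zero_mul, mul_zero, smul_zero,
        add_zero]
  refine TensorProduct.ext' fun f a => ?_
  have h3 : (f ⊗ₜ[ℝ] a : SuperFun q V) = (f ⊗ₜ[ℝ] 1) * (1 ⊗ₜ[ℝ] a) := by simp
  rw [h3, hD.leibniz_even (isHomog_tmul_one f), h1, h2, zero_mul, mul_zero, add_zero]
  rfl

theorem eq_of_pderiv_inr_eq_zero {f : SuperFun q V}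
    (hf : ∀ j, pderiv q V (Sum.inr j) f = 0) : f = body f ⊗ₜ[ℝ] 1 := by
  refine ext_eval fun x => ?_
  have h := ExteriorAlgebra.eq_algebraMap_of_contractLeft_eq_zero (a := eval x f) fun j => by
    rw [← eval_pderiv_inr, hf, map_zero]
  rw [eval_tmul, ← algebraMapInv_eval, ← Algebra.algebraMap_eq_smul_one]
  exact h

theorem sub_body_pow (f : SuperFun q V) : (f - body f ⊗ₜ[ℝ] 1) ^ (q + 1) = 0 := by
  refine ext_eval fun x => ?_
  rw [map_pow, map_zero]
  refine ExteriorAlgebra.pow_eq_zero_of_algebraMapInv_eq_zero ?_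
  rw [algebraMapInv_eval, map_sub, body_tmul_one, sub_self]
  rfl

/-- A function differs from its body by a nilpotent element commuting with the body. -/
theorem isUnit_iff {f : SuperFun q V} : IsUnit f ↔ ∀ x, (body f).1 x ≠ 0 := by
  constructor
  · intro h x
    exact (((h.map body).map (SmoothFun V).val).map (Pi.evalAlgHom ℝ (fun _ : V => ℝ) x)).ne_zero
  · intro h
    have h1 : IsUnit (body f ⊗ₜ[ℝ] 1 : SuperFun q V) := by
      refine IsUnit.map (Algebra.TensorProduct.includeLeft : SmoothFun V →ₐ[ℝ] SuperFun q V) ?_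
      -- The exponents `0` and `1` give `|b|^0 b^{-1}`, the smooth inverse of the body.
      refine IsUnit.of_mul_eq_one (SmoothFun.absPowDiv (body f) 0 1) ?_
      rw [SmoothFun.mul_absPowDiv_succ h]
      ext x
      rw [SmoothFun.absPowDiv_apply h]
      simp
    have h2 := IsNilpotent.isUnit_add_left_of_commute ⟨q + 1, sub_body_pow f⟩ h1
      (isSuperComm.commute (isHomog_tmul_one _) _).symm
    simpa using h2

end SuperFun

/-! ## Real powers of even functions -/

theorem Ring.choose_succ_mul (w : ℝ) (k : ℕ) :
    Ring.choose w (k + 1) * (k + 1) = Ring.choose w k * (w - k) := by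
  have h1 := Ring.descPochhammer_eq_factorial_smul_choose w (k + 1)
  have h2 := Ring.descPochhammer_eq_factorial_smul_choose w k
  rw [descPochhammer_succ_right, Polynomial.smeval_mul, h2, Nat.factorial_succ] at h1
  simp only [nsmul_eq_mul, Polynomial.smeval_sub, Polynomial.smeval_X, Polynomial.smeval_natCast,
    pow_one, pow_zero, mul_one, Nat.cast_mul, Nat.cast_add, Nat.cast_one] at h1
  have h3 : (k.factorial : ℝ) ≠ 0 := by positivity
  apply mul_left_cancel₀ h3
  linarith

/-! ### The differential equation of the truncated binomial series. -/

section BinomialSeries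

variable {R : Type*} [Ring R] [Algebra ℝ R] {π : R →ₐ[ℝ] R} {i : ZMod 2} {D : R →ₗ[ℝ] R}

theorem IsSuperDer.map_pow (H : IsSuperComm π) (hD : IsSuperDer π i D) {n : R}
    (hn : IsHomog π 0 n) (k : ℕ) : D (n ^ (k + 1)) = ((k : ℝ) + 1) • (n ^ k * D n) := by
  induction k with
  | zero => simp
  | succ k ih =>
    rw [pow_succ, hD.leibniz_even (hn.pow _), ih, smul_mul_assoc, mul_assoc,
      ← H.even_mul hn (D n), ← mul_assoc, ← pow_succ]
    push_cast
    rw [← one_smul ℝ (n ^ (k + 1) * D n), smul_smul, ← add_smul, mul_one, one_smul]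

/-- The differential equation `g h' = w g' h` for the binomial series
`h = ∑ (w choose k) b^{w-k} n^k` of `g = b + n`. -/
theorem IsSuperDer.map_binomialSeries (H : IsSuperComm π) (hD : IsSuperDer π i D) {b n : R}
    {β : ℕ → R} {w : ℝ} {m : ℕ} (hn : IsHomog π 0 n)
    (hβ : ∀ k, IsHomog π 0 (β k)) (hnm : n ^ (m + 1) = 0) (hbβ : ∀ k, b * β (k + 1) = β k)
    (hDβ : ∀ k, D (β k) = (w - k) • (β (k + 1) * D b)) :
    (b + n) * D (∑ k ∈ Finset.range (m + 1), Ring.choose w k • (β k * n ^ k)) =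
      w • ((∑ k ∈ Finset.range (m + 1), Ring.choose w k • (β k * n ^ k)) * D (b + n)) := by
  -- Differentiating `n^{m+1} = 0` gives this relation, which removes the boundary term left by
  -- truncating the series.
  have hz : n ^ m * D n = 0 := by
    have h1 := hD.map_pow H hn m
    rw [hnm, map_zero] at h1
    exact (smul_eq_zero.1 h1.symm).resolve_left (by positivity)
  -- `T` is the formal derivative of `h` with respect to `g`. It remains to check `D h = T D g` and
  -- `g T = w h`.
  set T : R := ∑ k ∈ Finset.range (m + 1), (Ring.choose w k * (w - k)) • (β (k + 1) * n ^ k) with hT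
  have hDh : D (∑ k ∈ Finset.range (m + 1), Ring.choose w k • (β k * n ^ k)) = T * D (b + n) := by
    have h1 : ∑ k ∈ Finset.range (m + 1), Ring.choose w k • (β k * D (n ^ k)) = T * D n := by
      rw [hT, Finset.sum_range_succ', Finset.sum_range_succ, add_mul, smul_mul_assoc _ (_ * n ^ m),
        mul_assoc _ (n ^ m), hz, pow_zero, hD.map_one, Finset.sum_mul]
      simp only [mul_zero, smul_zero, add_zero]
      refine Finset.sum_congr rfl fun k _ => ?_
      rw [hD.map_pow H hn, mul_smul_comm, smul_smul, Ring.choose_succ_mul, smul_mul_assoc,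
        mul_assoc]
    have h2 : ∑ k ∈ Finset.range (m + 1), Ring.choose w k • (D (β k) * n ^ k) = T * D b := by
      rw [hT, Finset.sum_mul]
      refine Finset.sum_congr rfl fun k _ => ?_
      rw [hDβ, smul_mul_assoc, smul_smul, mul_assoc, ← H.even_mul (hn.pow k) (D b),
        smul_mul_assoc, mul_assoc]
    rw [map_sum, map_add, mul_add, ← h1, ← h2, ← Finset.sum_add_distrib]
    refine Finset.sum_congr rfl fun k _ => ?_
    rw [map_smul, hD.leibniz_even (hβ k), smul_add]
  -- Multiplication by `b` contributes the coefficient `w - k` in degree `k`, and multiplication by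
  -- `n` contributes `k`.
  have hgT : (b + n) * T = w • ∑ k ∈ Finset.range (m + 1), Ring.choose w k • (β k * n ^ k) := by
    have h1 : b * T = ∑ k ∈ Finset.range (m + 1), (Ring.choose w k * (w - k)) • (β k * n ^ k) := by
      rw [hT, Finset.mul_sum]
      refine Finset.sum_congr rfl fun k _ => ?_
      rw [mul_smul_comm, ← mul_assoc, hbβ]
    have h2 : n * T = ∑ k ∈ Finset.range (m + 1), (Ring.choose w k * k) • (β k * n ^ k) := by
      have h3 : ∀ k, n * (β (k + 1) * n ^ k) = β (k + 1) * n ^ (k + 1) := fun k => by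
        rw [← mul_assoc, H.even_mul hn, mul_assoc, ← pow_succ']
      rw [hT, Finset.mul_sum, Finset.sum_range_succ,
        Finset.sum_range_succ' fun k => (Ring.choose w k * k) • (β k * n ^ k), mul_smul_comm, h3,
        hnm, mul_zero, smul_zero, add_zero, Nat.cast_zero, mul_zero, zero_smul, add_zero]
      refine Finset.sum_congr rfl fun k _ => ?_
      rw [mul_smul_comm, h3, ← Ring.choose_succ_mul]
      push_cast
      rfl
    rw [add_mul, h1, h2, ← Finset.sum_add_distrib, Finset.smul_sum]
    refine Finset.sum_congr rfl fun k _ => ?_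
    rw [← add_smul, smul_smul]
    congr 1
    ring
  rw [hDh, ← mul_assoc, hgT, smul_mul_assoc]

end BinomialSeries

namespace SuperFun

variable {p q : ℕ} {V V' : Opens (EuclideanSpace ℝ (Fin p))} {g : SuperFun q V}

theorem isHomog_sub_body (hg : IsHomog (parity q V) 0 g) :
    IsHomog (parity q V) 0 (g - body g ⊗ₜ[ℝ] 1) := hg.sub (isHomog_tmul_one _)

theorem isHomog_absPow (hg : IsHomog (parity q V) 0 g) (w : ℝ) :
    IsHomog (parity q V) 0 (absPow g w) :=
  IsHomog.sum fun k _ => IsHomog.smul _ <| by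
    simpa using (isHomog_tmul_one _).mul ((isHomog_sub_body hg).pow k)

theorem body_absPow (g : SuperFun q V) (w : ℝ) :
    body (absPow g w) = SmoothFun.absPowDiv (body g) w 0 := by
  rw [absPow, map_sum, Finset.sum_eq_single 0]
  · rw [map_smul, map_mul, pow_zero, body_tmul_one, map_one, mul_one, Ring.choose_zero_right,
      one_smul]
  · intro k _ hk
    rw [map_smul, map_mul, map_pow, map_sub, body_tmul_one, body_tmul_one, sub_self, zero_pow hk,
      mul_zero, smul_zero]
  · exact fun h => (h (Finset.mem_range.2 q.succ_pos)).elim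

theorem pderiv_tmul_absPowDiv {b : SmoothFun V} (hb : ∀ x, b.1 x ≠ 0) (w : ℝ) (k : ℕ)
    (a : Fin p ⊕ Fin q) :
    pderiv q V a (SmoothFun.absPowDiv b w k ⊗ₜ[ℝ] 1) =
      (w - k) • ((SmoothFun.absPowDiv b w (k + 1) ⊗ₜ[ℝ] 1) * pderiv q V a (b ⊗ₜ[ℝ] 1)) := by
  rcases a with i | j
  · rw [pderiv_inl_tmul, pderiv_inl_tmul, SmoothFun.pderiv_absPowDiv hb,
      Algebra.TensorProduct.tmul_mul_tmul, one_mul, TensorProduct.smul_tmul']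
  · have h : ∀ f : SmoothFun V, pderiv q V (Sum.inr j) (f ⊗ₜ[ℝ] 1) = 0 := fun f =>
      ext_eval fun x => by
        rw [eval_pderiv_inr, eval_tmul, map_smul, CliffordAlgebra.contractLeft_one, smul_zero,
          map_zero]
    rw [h, h, mul_zero, smul_zero]

theorem mul_pderiv_absPow (hg : IsHomog (parity q V) 0 g) (hu : IsUnit g) (w : ℝ)
    (a : Fin p ⊕ Fin q) :
    g * pderiv q V a (absPow g w) = w • (absPow g w * pderiv q V a g) := by
  have hb := isUnit_iff.1 hu
  have h := (isSuperDer_pderiv a).map_binomialSeries isSuperComm (w := w) (m := q)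
    (β := fun k => SmoothFun.absPowDiv (body g) w k ⊗ₜ[ℝ] 1)
    (isHomog_sub_body hg) (fun k => isHomog_tmul_one _) (sub_body_pow g)
    (fun k => by
      rw [Algebra.TensorProduct.tmul_mul_tmul, SmoothFun.mul_absPowDiv_succ hb, one_mul])
    (fun k => pderiv_tmul_absPowDiv hb w k a)
  rwa [add_sub_cancel] at h

theorem restrict_absPow (h : V' ≤ V) (hu : IsUnit g) (w : ℝ) :
    restrict q h (absPow g w) = absPow (restrict q h g) w := by
  simp only [absPow, map_sum, map_smul, map_mul, map_pow, map_sub, restrict_tmul, body_restrict,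
    SmoothFun.restrict_absPowDiv h (isUnit_iff.1 hu)]

/-- The default value matters: if the body of `g` has a zero, `SmoothFun.absPowDiv` is `0`, so the
power has zero body and cannot be invertible at that point. -/
theorem isUnit_of_isUnit_absPow {w : ℝ} (h : IsUnit (absPow g w)) : IsUnit g := by
  rw [isUnit_iff] at h ⊢
  by_contra h0
  push Not at h0
  obtain ⟨x, hx⟩ := h0
  refine h x ?_
  rw [body_absPow, SmoothFun.absPowDiv, dif_neg fun h' => h' x hx]
  rfl

theorem isUnit_absPow (hu : IsUnit g) (w : ℝ) : IsUnit (absPow g w) := by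
  rw [isUnit_iff] at hu ⊢
  intro x
  rw [body_absPow, SmoothFun.absPowDiv_apply hu, pow_zero, div_one]
  exact (Real.rpow_pos_of_pos (abs_pos.2 (hu x)) w).ne'

end SuperFun

/-! ## Differential equations for powers -/

section PowerEquation

variable {R : Type*} [Ring R] [Algebra ℝ R] {π : R →ₐ[ℝ] R} {i : ZMod 2} {D : R →ₗ[ℝ] R}
  {g h g' h' : R} {w : ℝ}

/-- The quotient of two solutions of `g D h = w h D g` is constant, by the quotient rule and
cancellation of the unit `g`. -/
theorem IsSuperDer.map_mul_inverse_eq_zero (H : IsSuperComm π) (hD : IsSuperDer π i D)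
    (hg : IsHomog π 0 g) (hh : IsHomog π 0 h) (hh' : IsHomog π 0 h') (hgu : IsUnit g)
    (hu : IsUnit h') (e : g * D h = w • (h * D g)) (e' : g * D h' = w • (h' * D g)) :
    D (h * Ring.inverse h') = 0 := by
  have hI := hh'.inverse
  have h1 : h' * Ring.inverse h' = 1 := Ring.mul_inverse_cancel _ hu
  apply hgu.mul_left_cancel
  rw [hD.leibniz_even hh, hD.map_inverse H hh' hu, mul_zero, mul_add, ← mul_assoc, e, mul_neg,
    mul_neg, ← mul_assoc g, H.even_mul hg h]
  have h2 : h * g * (Ring.inverse h' * Ring.inverse h' * D h') =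
      h * (Ring.inverse h' * (Ring.inverse h' * (g * D h'))) := by
    rw [mul_assoc h g, mul_assoc (Ring.inverse h'), ← mul_assoc g, H.even_mul hg (Ring.inverse h'),
      mul_assoc (Ring.inverse h') g, ← mul_assoc g (Ring.inverse h'),
      H.even_mul hg (Ring.inverse h'), mul_assoc (Ring.inverse h') g]
  rw [h2, e', mul_smul_comm, mul_smul_comm, mul_smul_comm, ← mul_assoc (Ring.inverse h') h',
    H.even_mul hI h', h1, one_mul, smul_mul_assoc, mul_assoc, H.even_mul hI (D g), add_neg_cancel]

theorem IsSuperDer.powerEquation_mul (H : IsSuperComm π) (hD : IsSuperDer π i D)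
    (hg : IsHomog π 0 g) (hh : IsHomog π 0 h) (hg' : IsHomog π 0 g') (hh' : IsHomog π 0 h')
    (e : g * D h = w • (h * D g)) (e' : g' * D h' = w • (h' * D g')) :
    (g * g') * D (h * h') = w • ((h * h') * D (g * g')) := by
  rw [hD.leibniz_even hh, hD.leibniz_even hg, mul_add, mul_add, smul_add]
  congr 1
  · calc g * g' * (D h * h') = (g * D h) * (g' * h') := by
          rw [mul_assoc g, ← mul_assoc g' (D h), H.even_mul hg' (D h)]
          simp only [mul_assoc]
      _ = w • (h * h' * (D g * g')) := by
          rw [e, smul_mul_assoc, H.even_mul hg' h', mul_assoc, ← mul_assoc (D g),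
            ← H.even_mul hh' (D g)]
          simp only [mul_assoc]
  · calc g * g' * (h * D h') = (g * h) * (g' * D h') := by
          rw [mul_assoc g, ← mul_assoc g' h, H.even_mul hg' h]
          simp only [mul_assoc]
      _ = w • (h * h' * (g * D g')) := by
          rw [e', mul_smul_comm, H.even_mul hg h, mul_assoc, ← mul_assoc g, H.even_mul hg h']
          simp only [mul_assoc]

/-- A power `w` of a power `1` satisfies the equation of the power `w`; this serves for `||g|^1|^w`.
-/
theorem IsSuperDer.powerEquation_comp (H : IsSuperComm π) (hg : IsHomog π 0 g)
    (hh : IsHomog π 0 h) (hu : IsUnit h)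
    (e : g * D h = (1 : ℝ) • (h * D g)) (e' : h * D h' = w • (h' * D h)) :
    g * D h' = w • (h' * D g) := by
  apply hu.mul_left_cancel
  rw [one_smul] at e
  rw [← mul_assoc, H.even_mul hh g, mul_assoc, e', mul_smul_comm, mul_smul_comm, ← mul_assoc,
    H.even_mul hg h', mul_assoc, e, ← mul_assoc, ← mul_assoc, H.even_mul hh h']

end PowerEquation

/-! ## Calculus in the charts of a superspace -/

namespace SuperSpace

variable {M : SuperSpace.{u}}

theorem mem_homog_iff {U : Opens M.carrier} {i : ZMod 2} {f : M.O U} :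
    f ∈ M.homog U i ↔ IsHomog (M.par U) i f := mem_homog

theorem isHomog_res {U V : Opens M.carrier} (h : U ≤ V) {i : ZMod 2} {f : M.O V}
    (hf : IsHomog (M.par V) i f) : IsHomog (M.par U) i (M.res h f) :=
  mem_homog_iff.1 (res_mem_homog h (mem_homog_iff.2 hf))

namespace Chart

variable {p q : ℕ} (c d : M.Chart p q) {W W' : Opens M.carrier} (hW : W ≤ c.source)
  (hW' : W ≤ d.source)

theorem isHomog_iso_iff {i : ZMod 2} {f : M.O W} :
    IsHomog (SuperFun.parity q _) i (c.iso W hW f) ↔ IsHomog (M.par W) i f := by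
  unfold IsHomog
  rw [← c.iso_par W hW f, ← map_smul, (c.iso W hW).injective.eq_iff]

include hW in
theorem isSuperComm : IsSuperComm (M.par W) where
  invol := M.par_par
  comm i j f g hf hg := by
    apply (c.iso W hW).injective
    rw [map_smul, map_mul, map_mul]
    exact SuperFun.isSuperComm.comm i j _ _ ((c.isHomog_iso_iff hW).2 hf)
      ((c.isHomog_iso_iff hW).2 hg)

theorem iso_pderiv (a : Fin p ⊕ Fin q) (f : M.O W) :
    c.iso W hW (c.pderiv hW a f) = SuperFun.pderiv q _ a (c.iso W hW f) :=
  (c.iso W hW).apply_symm_apply _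

theorem iso_coord (a : Fin p ⊕ Fin q) : c.iso W hW (c.coord hW a) = SuperFun.coord q _ a :=
  (c.iso W hW).apply_symm_apply _

theorem iso_absPow (g : M.O W) (w : ℝ) :
    c.iso W hW (c.absPow hW g w) = SuperFun.absPow (c.iso W hW g) w :=
  (c.iso W hW).apply_symm_apply _

theorem isSuperDer_pderiv (a : Fin p ⊕ Fin q) :
    IsSuperDer (M.par W) (coordParity a) (c.pderiv hW a) where
  mem j g hg := by
    rw [← c.isHomog_iso_iff hW, iso_pderiv]
    exact (SuperFun.isSuperDer_pderiv a).mem j _ ((c.isHomog_iso_iff hW).2 hg)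
  leibniz j g h hg := by
    apply (c.iso W hW).injective
    simp only [map_add, map_mul, map_smul, iso_pderiv]
    exact (SuperFun.isSuperDer_pderiv a).leibniz j _ _ ((c.isHomog_iso_iff hW).2 hg)

theorem isHomog_coord (a : Fin p ⊕ Fin q) :
    IsHomog (M.par W) (coordParity a) (c.coord hW a) := by
  rw [← c.isHomog_iso_iff hW, iso_coord]
  exact SuperFun.isHomog_coord a

theorem pderiv_coord (a b : Fin p ⊕ Fin q) :
    c.pderiv hW a (c.coord hW b) = if a = b then 1 else 0 := by
  apply (c.iso W hW).injective
  rw [iso_pderiv, iso_coord, SuperFun.pderiv_coord]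
  split_ifs <;> simp

theorem res_pderiv (h : W' ≤ W) (a : Fin p ⊕ Fin q) (f : M.O W) :
    M.res h (c.pderiv hW a f) = c.pderiv (h.trans hW) a (M.res h f) := by
  apply (c.iso W' (h.trans hW)).injective
  rw [c.iso_res W' W h hW, iso_pderiv, iso_pderiv, c.iso_res W' W h hW, SuperFun.restrict_pderiv]

theorem res_coord (h : W' ≤ W) (a : Fin p ⊕ Fin q) :
    M.res h (c.coord hW a) = c.coord (h.trans hW) a := by
  apply (c.iso W' (h.trans hW)).injective
  rw [c.iso_res W' W h hW, iso_coord, iso_coord, SuperFun.restrict_coord]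

theorem isUnit_iso_iff {g : M.O W} : IsUnit (c.iso W hW g) ↔ IsUnit g :=
  MulEquiv.isUnit_map (c.iso W hW)

theorem res_absPow (h : W' ≤ W) {g : M.O W} (hg : IsUnit g) (w : ℝ) :
    M.res h (c.absPow hW g w) = c.absPow (h.trans hW) (M.res h g) w := by
  apply (c.iso W' (h.trans hW)).injective
  rw [c.iso_res W' W h hW, iso_absPow, iso_absPow, c.iso_res W' W h hW,
    SuperFun.restrict_absPow _ ((c.isUnit_iso_iff hW).2 hg)]

theorem isHomog_absPow {g : M.O W} (hg : IsHomog (M.par W) 0 g) (w : ℝ) :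
    IsHomog (M.par W) 0 (c.absPow hW g w) := by
  rw [← c.isHomog_iso_iff hW, iso_absPow]
  exact SuperFun.isHomog_absPow ((c.isHomog_iso_iff hW).2 hg) w

theorem isUnit_absPow {g : M.O W} (hg : IsUnit g) (w : ℝ) : IsUnit (c.absPow hW g w) := by
  rw [← c.isUnit_iso_iff hW, iso_absPow]
  exact SuperFun.isUnit_absPow ((c.isUnit_iso_iff hW).2 hg) w

theorem isUnit_of_isUnit_absPow {g : M.O W} {w : ℝ} (h : IsUnit (c.absPow hW g w)) :
    IsUnit g := by
  rw [← c.isUnit_iso_iff hW, iso_absPow] at h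
  exact (c.isUnit_iso_iff hW).1 (SuperFun.isUnit_of_isUnit_absPow h)

/-- A derivation is determined by its values on the coordinates. -/
theorem superDer_apply {i : ZMod 2} {D : M.O W →ₗ[ℝ] M.O W} (hD : IsSuperDer (M.par W) i D)
    (f : M.O W) : D f = ∑ a, D (c.coord hW a) * c.pderiv hW a f := by
  -- `D₁` is a derivation of the same parity with the same values on coordinates; the difference,
  -- transported to the superdomain, vanishes by `SuperFun.superDer_eq_zero`.
  let D₁ : M.O W →ₗ[ℝ] M.O W := ∑ a, LinearMap.mulLeft ℝ (D (c.coord hW a)) ∘ₗ c.pderiv hW a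
  have hD₁ : IsSuperDer (M.par W) i D₁ := IsSuperDer.sum fun a _ => by
    have h := (c.isSuperDer_pderiv hW a).mulLeft (c.isSuperComm hW)
      (hD.mem _ _ (c.isHomog_coord hW a))
    rwa [add_assoc, CharTwo.add_self_eq_zero, add_zero] at h
  have hD₂ := hD.sub hD₁
  let D₂ : SuperFun q (image c.toHomeo W) →ₗ[ℝ] SuperFun q (image c.toHomeo W) :=
    (c.iso W hW).toLinearMap ∘ₗ (D - D₁) ∘ₗ (c.iso W hW).symm.toLinearMap
  have hs : ∀ {j : ZMod 2} {g : SuperFun q (image c.toHomeo W)},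
      IsHomog (SuperFun.parity q _) j g → IsHomog (M.par W) j ((c.iso W hW).symm g) := by
    intro j g hg
    rw [← c.isHomog_iso_iff hW, AlgEquiv.apply_symm_apply]
    exact hg
  have hD₂' : IsSuperDer (SuperFun.parity q _) i D₂ :=
    { mem := fun j g hg => (c.isHomog_iso_iff hW).2 (hD₂.mem j _ (hs hg))
      leibniz := fun j g h hg => by
        change c.iso W hW ((D - D₁) ((c.iso W hW).symm (g * h))) =
          c.iso W hW ((D - D₁) ((c.iso W hW).symm g)) * h +
            paritySign (i * j) • (g * c.iso W hW ((D - D₁) ((c.iso W hW).symm h)))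
        rw [map_mul, hD₂.leibniz j _ _ (hs hg), map_add, map_mul, map_smul, map_mul,
          AlgEquiv.apply_symm_apply, AlgEquiv.apply_symm_apply] }
  have h0 : D₂ = 0 := SuperFun.superDer_eq_zero hD₂' fun b => by
    change c.iso W hW ((D - D₁) (c.coord hW b)) = 0
    have : D₁ (c.coord hW b) = D (c.coord hW b) := by
      simp only [D₁, LinearMap.sum_apply, LinearMap.comp_apply, LinearMap.mulLeft_apply,
        pderiv_coord, mul_ite, mul_one, mul_zero, Finset.sum_ite_eq', Finset.mem_univ, if_true]
    rw [LinearMap.sub_apply, this, sub_self, map_zero]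
  have h1 := LinearMap.congr_fun h0 (c.iso W hW f)
  change c.iso W hW ((D - D₁) ((c.iso W hW).symm (c.iso W hW f))) = 0 at h1
  rw [AlgEquiv.symm_apply_apply, map_eq_zero_iff _ (c.iso W hW).injective, LinearMap.sub_apply,
    sub_eq_zero] at h1
  rw [h1]
  simp [D₁, LinearMap.sum_apply]

/-- Expanding `D = ∑ D(x^a) ∂_a` extends the power equation from coordinate derivatives to all
derivations, in particular to the coordinate derivatives of another chart. -/
theorem mul_map_absPow {i : ZMod 2} {D : M.O W →ₗ[ℝ] M.O W} (hD : IsSuperDer (M.par W) i D)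
    {g : M.O W} (hg : IsHomog (M.par W) 0 g) (hu : IsUnit g) (w : ℝ) :
    g * D (c.absPow hW g w) = w • (c.absPow hW g w * D g) := by
  have H := c.isSuperComm hW
  rw [c.superDer_apply hW hD, c.superDer_apply hW hD g, Finset.mul_sum, Finset.mul_sum,
    Finset.smul_sum]
  refine Finset.sum_congr rfl fun a _ => ?_
  have h : g * c.pderiv hW a (c.absPow hW g w) = w • (c.absPow hW g w * c.pderiv hW a g) := by
    apply (c.iso W hW).injective
    rw [map_smul, map_mul, map_mul, iso_pderiv, iso_pderiv, iso_absPow]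
    exact SuperFun.mul_pderiv_absPow ((c.isHomog_iso_iff hW).2 hg) ((c.isUnit_iso_iff hW).2 hu) w a
  rw [← mul_assoc, H.even_mul hg, mul_assoc, h, mul_smul_comm, ← mul_assoc, ← mul_assoc,
    H.even_mul (c.isHomog_absPow hW hg w)]

/-! ### The value of a function at a point -/

include hW in
theorem apply_mem_image {x : M.carrier} (hx : x ∈ W) : c.toHomeo x ∈ image c.toHomeo W := by
  have hxs : x ∈ c.toHomeo.source := c.source_eq ▸ hW hx
  refine ⟨c.toHomeo.map_source hxs, ?_⟩
  change c.toHomeo.symm (c.toHomeo x) ∈ W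
  rwa [c.toHomeo.left_inv hxs]

/-- The value of a function at a point, computed in a chart. -/
noncomputable def value (x : M.carrier) (hx : x ∈ W) : M.O W →ₐ[ℝ] ℝ :=
  ((Pi.evalAlgHom ℝ (fun _ : image c.toHomeo W => ℝ) ⟨c.toHomeo x, c.apply_mem_image hW hx⟩).comp
    (SmoothFun (image c.toHomeo W)).val).comp (SuperFun.body.comp (c.iso W hW).toAlgHom)

theorem value_apply (x : M.carrier) (hx : x ∈ W) (f : M.O W) : c.value hW x hx f =
    (SuperFun.body (c.iso W hW f)).1 ⟨c.toHomeo x, c.apply_mem_image hW hx⟩ := rfl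

theorem body_eq_value (f : M.O W) (y : image c.toHomeo W) :
    (SuperFun.body (c.iso W hW f)).1 y = c.value hW (c.toHomeo.symm y.1) y.2.2 f := by
  rw [value_apply]
  exact congrArg _ (Subtype.ext (c.toHomeo.right_inv y.2.1).symm)

theorem isUnit_iff_value {f : M.O W} : IsUnit f ↔ ∀ x hx, c.value hW x hx f ≠ 0 := by
  rw [← c.isUnit_iso_iff hW, SuperFun.isUnit_iff]
  refine ⟨fun h x hx => h _, fun h y => ?_⟩
  rw [body_eq_value]
  exact h _ _

theorem value_res (h : W' ≤ W) (x : M.carrier) (hx : x ∈ W') (f : M.O W) :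
    c.value (h.trans hW) x hx (M.res h f) = c.value hW x (h hx) f := by
  rw [value_apply, c.iso_res W' W h hW, SuperFun.body_restrict]
  rfl

/-- The right-hand side mentions no chart. By continuity, a nonzero value means that the body has no
zeros near `x`, that is, that `f` is invertible there. -/
theorem value_ne_zero_iff (x : M.carrier) (hx : x ∈ W) (f : M.O W) :
    c.value hW x hx f ≠ 0 ↔ ∃ (W' : Opens M.carrier) (h : W' ≤ W), x ∈ W' ∧
      IsUnit (M.res h f) := by
  constructor
  · intro h0
    set b := SuperFun.body (c.iso W hW f) with hb
    have h1 : IsOpen ((image c.toHomeo W : Set (EuclideanSpace ℝ (Fin p))) ∩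
        extendZero b.1 ⁻¹' {0}ᶜ) :=
      b.2.continuousOn.isOpen_inter_preimage (image c.toHomeo W).2 isOpen_compl_singleton
    have h2 := c.toHomeo.isOpen_inter_preimage h1
    have hle : (⟨_, h2⟩ : Opens M.carrier) ≤ W := by
      intro y hy
      have h3 : c.toHomeo.symm (c.toHomeo y) ∈ W := hy.2.1.2
      rwa [c.toHomeo.left_inv hy.1] at h3
    refine ⟨⟨_, h2⟩, hle, ⟨?_, c.apply_mem_image hW hx, ?_⟩, ?_⟩
    · exact c.source_eq ▸ hW hx
    · change extendZero b.1 _ ≠ 0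
      rw [extendZero_apply _ (c.apply_mem_image hW hx)]
      exact h0
    · rw [c.isUnit_iff_value (hle.trans hW)]
      intro y hy
      rw [value_res _ hW]
      have h3 : extendZero b.1 (c.toHomeo y) ≠ 0 := hy.2.2
      rwa [extendZero_apply _ (c.apply_mem_image hW (hle hy))] at h3
  · rintro ⟨W', h, hx', hu⟩
    have := (c.isUnit_iff_value (h.trans hW)).1 hu x hx'
    rwa [value_res _ hW] at this

/-- The value of a function at a point does not depend on the chart. -/
theorem value_eq (x : M.carrier) (hx : x ∈ W) (f : M.O W) :
    c.value hW x hx f = d.value hW' x hx f := by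
  by_contra hne
  -- If the two values differed, `f` minus its value in `c` would be invertible near `x` according
  -- to `d`, although its value in `c` is zero.
  have h1 : d.value hW' x hx (f - algebraMap ℝ _ (c.value hW x hx f)) ≠ 0 := by
    rw [map_sub, AlgHom.commutes]
    exact sub_ne_zero.2 (Ne.symm hne)
  rw [value_ne_zero_iff, ← c.value_ne_zero_iff hW x hx, map_sub, AlgHom.commutes] at h1
  exact h1 (sub_self _)

theorem value_absPow {g : M.O W} (hu : IsUnit g) (w : ℝ) (x : M.carrier) (hx : x ∈ W) :
    c.value hW x hx (c.absPow hW g w) = |c.value hW x hx g| ^ w := by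
  rw [value_apply, iso_absPow, SuperFun.body_absPow, SmoothFun.absPowDiv_apply
    (SuperFun.isUnit_iff.1 ((c.isUnit_iso_iff hW).2 hu)), pow_zero, div_one, value_apply]

/-- A function with vanishing odd derivatives equals its body, and the body is prescribed at every
point, so `W` may be disconnected. -/
theorem eq_one_of_pderiv_eq_zero {f : M.O W} (h : ∀ a, c.pderiv hW a f = 0)
    (h' : ∀ x hx, c.value hW x hx f = 1) : f = 1 := by
  apply (c.iso W hW).injective
  rw [SuperFun.eq_of_pderiv_inr_eq_zero (f := c.iso W hW f) fun j => by
    rw [← iso_pderiv, h, map_zero], map_one]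
  have h1 : SuperFun.body (c.iso W hW f) = 1 := by
    ext y
    rw [body_eq_value, h']
    rfl
  rw [h1, Algebra.TensorProduct.one_def]

/-- Solutions of the power equation are determined by their values. -/
theorem eq_of_powerEquation {g h h' : M.O W} {w : ℝ} (hg : IsHomog (M.par W) 0 g)
    (hgu : IsUnit g) (hh : IsHomog (M.par W) 0 h) (hh' : IsHomog (M.par W) 0 h') (hu : IsUnit h')
    (e : ∀ a, g * c.pderiv hW a h = w • (h * c.pderiv hW a g))
    (e' : ∀ a, g * c.pderiv hW a h' = w • (h' * c.pderiv hW a g))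
    (hv : ∀ x hx, c.value hW x hx h = c.value hW x hx h') : h = h' := by
  have H := c.isSuperComm hW
  have h1 : h * Ring.inverse h' = 1 := by
    refine c.eq_one_of_pderiv_eq_zero hW (fun a => (c.isSuperDer_pderiv hW a).map_mul_inverse_eq_zero
      H hg hh hh' hgu hu (e a) (e' a)) fun x hx => ?_
    rw [map_mul, hv, ← map_mul, Ring.mul_inverse_cancel _ hu, map_one]
  calc h = h * (Ring.inverse h' * h') := by rw [Ring.inverse_mul_cancel _ hu, mul_one]
    _ = h' := by rw [← mul_assoc, h1, one_mul]

/-- The nilpotent part of `g` depends on the chart, so the two series differ term by term. Both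
solve the power equation for the derivatives of `c`, with the same values at points. -/
theorem absPow_eq_absPow {g : M.O W} (hg : IsHomog (M.par W) 0 g) (hu : IsUnit g) (w : ℝ) :
    c.absPow hW g w = d.absPow hW' g w :=
  c.eq_of_powerEquation hW hg hu (c.isHomog_absPow hW hg w) (d.isHomog_absPow hW' hg w)
    (d.isUnit_absPow hW' hu w) (fun a => c.mul_map_absPow hW (c.isSuperDer_pderiv hW a) hg hu w)
    (fun a => d.mul_map_absPow hW' (c.isSuperDer_pderiv hW a) hg hu w) fun x hx => by
      rw [c.value_absPow hW hu, c.value_eq d hW hW', c.value_eq d hW hW', d.value_absPow hW' hu]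

theorem absPow_mul {g g' : M.O W} (hg : IsHomog (M.par W) 0 g) (hg' : IsHomog (M.par W) 0 g')
    (hu : IsUnit g) (hu' : IsUnit g') (w : ℝ) :
    c.absPow hW (g * g') w = c.absPow hW g w * c.absPow hW g' w := by
  have hgg : IsHomog (M.par W) 0 (g * g') := by simpa using hg.mul hg'
  refine c.eq_of_powerEquation hW hgg (hu.mul hu') (c.isHomog_absPow hW hgg w)
    (by simpa using (c.isHomog_absPow hW hg w).mul (c.isHomog_absPow hW hg' w))
    ((c.isUnit_absPow hW hu w).mul (c.isUnit_absPow hW hu' w))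
    (fun a => c.mul_map_absPow hW (c.isSuperDer_pderiv hW a) hgg (hu.mul hu') w)
    (fun a => (c.isSuperDer_pderiv hW a).powerEquation_mul (c.isSuperComm hW) hg
      (c.isHomog_absPow hW hg w) hg' (c.isHomog_absPow hW hg' w)
      (c.mul_map_absPow hW (c.isSuperDer_pderiv hW a) hg hu w)
      (c.mul_map_absPow hW (c.isSuperDer_pderiv hW a) hg' hu' w)) fun x hx => ?_
  rw [map_mul, c.value_absPow hW (hu.mul hu'), c.value_absPow hW hu, c.value_absPow hW hu', map_mul,
    abs_mul, Real.mul_rpow (abs_nonneg _) (abs_nonneg _)]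

/-- Needed because the law of a volume form contains `|Ber|^1`, which is raised to the power `w`
when passing to `ρ^w`. -/
theorem absPow_absPow_one {g : M.O W} (hg : IsHomog (M.par W) 0 g) (hu : IsUnit g) (w : ℝ) :
    c.absPow hW (c.absPow hW g 1) w = c.absPow hW g w := by
  have h1 := c.isHomog_absPow hW hg 1
  have hu1 := c.isUnit_absPow hW hu 1
  refine c.eq_of_powerEquation hW hg hu (c.isHomog_absPow hW h1 w) (c.isHomog_absPow hW hg w)
    (c.isUnit_absPow hW hu w)
    (fun a => IsSuperDer.powerEquation_comp (c.isSuperComm hW) hg h1 hu1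
      (c.mul_map_absPow hW (c.isSuperDer_pderiv hW a) hg hu 1)
      (c.mul_map_absPow hW (c.isSuperDer_pderiv hW a) h1 hu1 w))
    (fun a => c.mul_map_absPow hW (c.isSuperDer_pderiv hW a) hg hu w) fun x hx => ?_
  rw [c.value_absPow hW hu1, c.value_absPow hW hu, c.value_absPow hW hu, Real.rpow_one, abs_abs]

end Chart

end SuperSpace

/-! ## Divergence and the Jacobi matrix -/

namespace SuperSpace.Chart

variable {M : SuperSpace.{u}} {p q : ℕ} (c d : M.Chart p q) {W W' : Opens M.carrier}
  (hW : W ≤ c.source) (hW' : W ≤ d.source) {i j : ZMod 2} {D : M.O W →ₗ[ℝ] M.O W}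

/-- The divergence of a derivation of parity `i` in the coordinates of a chart. -/
noncomputable def coordDiv (i : ZMod 2) (D : M.O W →ₗ[ℝ] M.O W) : M.O W :=
  ∑ a, paritySign (coordParity a * (i + 1)) • c.pderiv hW a (D (c.coord hW a))

theorem isHomog_coordDiv (hD : IsSuperDer (M.par W) i D) :
    IsHomog (M.par W) i (c.coordDiv hW i D) := IsHomog.sum fun a _ => IsHomog.smul _ <| by
  have h := (c.isSuperDer_pderiv hW a).mem _ _ (hD.mem _ _ (c.isHomog_coord hW a))
  rwa [add_left_comm, CharTwo.add_self_eq_zero, add_zero] at h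

theorem isHomog_jacobian (a b : Fin p ⊕ Fin q) :
    IsHomog (M.par W) (coordParity a + coordParity b) (c.jacobian hW d hW' a b) :=
  (c.isSuperDer_pderiv hW a).mem _ _ (d.isHomog_coord hW' b)

theorem isHomog_berezinian_jacobian :
    IsHomog (M.par W) 0 (berezinian (c.jacobian hW d hW')) :=
  isHomog_berezinian (c.isSuperComm hW) (c.isHomog_jacobian d hW hW')

/-- Commuting `D` past `∂/∂x^a` gives `D J = ±(J N - K J)`, where `N` and `K` are the matrices of
derivatives of the components of `D` in the coordinates `y` and `x`. Their supertraces are the two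
divergences. -/
theorem map_berezinian_jacobian (hD : IsSuperDer (M.par W) i D)
    (hu : IsUnit (berezinian (c.jacobian hW d hW'))) :
    D (berezinian (c.jacobian hW d hW')) =
      (d.coordDiv hW' i D - c.coordDiv hW i D) * berezinian (c.jacobian hW d hW') := by
  rw [hD.map_berezinian (c.isSuperComm hW) (N := Matrix.of fun a b =>
      d.pderiv hW' a (D (d.coord hW' b))) (K := Matrix.of fun a b =>
      c.pderiv hW a (D (c.coord hW b))) (c.isHomog_jacobian d hW hW') (fun a b => ?_)
      (fun a b => ?_) (fun a b => ?_) hu]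
  · simp only [Matrix.of_apply, smul_sub, Finset.sum_sub_distrib]
    rfl
  · rw [add_assoc, add_comm (coordParity b)]
    exact (d.isSuperDer_pderiv hW' a).mem _ _ (hD.mem _ _ (d.isHomog_coord hW' b))
  · rw [add_assoc, add_comm (coordParity b)]
    exact (c.isSuperDer_pderiv hW a).mem _ _ (hD.mem _ _ (c.isHomog_coord hW b))
  -- The supercommutator of `D` and `∂_a` is expanded in the coordinates `x`; since `D (∂_a x^e) =
  -- 0`, its components are those of `K` up to sign. The chain rule through `y` gives the term `J
  -- N`.
  · have h1 := c.superDer_apply hW (hD.commutator (c.isSuperDer_pderiv hW a)) (d.coord hW' b)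
    have h2 : ∀ e, D (c.pderiv hW a (c.coord hW e)) = 0 := fun e => by
      rw [pderiv_coord]
      split_ifs
      · exact hD.map_one
      · exact map_zero D
    simp only [LinearMap.sub_apply, LinearMap.smul_apply, LinearMap.comp_apply, h2, zero_sub,
      neg_mul, Finset.sum_neg_distrib, smul_mul_assoc] at h1
    rw [← Finset.smul_sum] at h1
    rw [Matrix.mul_apply, Matrix.mul_apply, smul_sub]
    refine (sub_eq_iff_eq_add.1 h1).trans ?_
    rw [d.superDer_apply hW' (c.isSuperDer_pderiv hW a) (D (d.coord hW' b)), neg_add_eq_sub]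
    rfl

/-- The transformation law of the Lie derivative. -/
theorem lieDerivative_transform (hD : IsSuperDer (M.par W) i D)
    (hu : IsUnit (berezinian (c.jacobian hW d hW'))) (w : ℝ) (s : M.O W) :
    D (s * c.absPow hW (berezinian (c.jacobian hW d hW')) w) +
      w • (c.coordDiv hW i D * (s * c.absPow hW (berezinian (c.jacobian hW d hW')) w)) =
    (D s + w • (d.coordDiv hW' i D * s)) *
      c.absPow hW (berezinian (c.jacobian hW d hW')) w := by
  have H := c.isSuperComm hW
  have hB := c.isHomog_berezinian_jacobian d hW hW'
  have hDB := c.map_berezinian_jacobian d hW hW' hD hu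
  have hh := c.isHomog_absPow hW hB w
  have e := c.mul_map_absPow hW hD hB hu w
  rw [hDB] at e
  generalize berezinian (c.jacobian hW d hW') = B at *
  generalize c.absPow hW B w = h at *
  -- The power equation with the unit `B` cancelled. Its `x`-divergence cancels the one in the Lie
  -- derivative, leaving the `y`-divergence.
  have hDh : D h = w • ((d.coordDiv hW' i D - c.coordDiv hW i D) * h) := by
    apply hu.mul_left_cancel
    rw [e, mul_smul_comm, ← mul_assoc, ← H.even_mul hB, H.even_mul hh]
  rw [← H.even_mul hh s, hD.leibniz_even hh, hDh, add_mul, ← H.even_mul hh (D s), smul_mul_assoc,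
    smul_mul_assoc, mul_assoc, sub_mul, smul_sub, mul_assoc (d.coordDiv hW' i D),
    H.even_mul hh s]
  abel

/-- The divergence of a multiple of a derivation. -/
theorem coordDiv_mulLeft {g : M.O W} (hg : IsHomog (M.par W) j g)
    (hD : IsSuperDer (M.par W) i D) :
    c.coordDiv hW (j + i) (LinearMap.mulLeft ℝ g ∘ₗ D) =
      g * c.coordDiv hW i D + paritySign (i * j) • D g := by
  have H := c.isSuperComm hW
  rw [c.superDer_apply hW hD g, coordDiv, coordDiv, Finset.mul_sum, Finset.smul_sum,
    ← Finset.sum_add_distrib]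
  refine Finset.sum_congr rfl fun a _ => ?_
  have hX := hD.mem _ _ (c.isHomog_coord hW a)
  have h1 := H.comm _ _ _ _ ((c.isSuperDer_pderiv hW a).mem _ _ hg) hX
  rw [LinearMap.comp_apply, LinearMap.mulLeft_apply, (c.isSuperDer_pderiv hW a).leibniz _ _ _ hg,
    h1, smul_add, smul_smul, smul_smul, mul_smul_comm, add_comm]
  congr 2 <;>
  · rcases ZMod.two_cases i with rfl | rfl <;> rcases ZMod.two_cases j with rfl | rfl <;>
      rcases ZMod.two_cases (coordParity a) with h | h <;> rw [h] <;>
      simp [show (1 + 1 : ZMod 2) = 0 from rfl]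

theorem coordDiv_add (D D' : M.O W →ₗ[ℝ] M.O W) :
    c.coordDiv hW i (D + D') = c.coordDiv hW i D + c.coordDiv hW i D' := by
  simp only [coordDiv, LinearMap.add_apply, map_add, smul_add, Finset.sum_add_distrib]

theorem coordDiv_smul (r : ℝ) (D : M.O W →ₗ[ℝ] M.O W) :
    c.coordDiv hW i (r • D) = r • c.coordDiv hW i D := by
  simp only [coordDiv, LinearMap.smul_apply, map_smul, Finset.smul_sum, smul_comm r]

end SuperSpace.Chart

/-! ## Densities on supermanifolds -/

namespace SuperSpace

variable {M : SuperSpace.{u}} {p q : ℕ}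

theorem exists_gluing {ι : Type u} (U : ι → Opens M.carrier) (hU : ∀ x, ∃ k, x ∈ U k)
    (s : ∀ k, M.O (U k))
    (hs : ∀ k l, M.res (inf_le_left : U k ⊓ U l ≤ U k) (s k) = M.res inf_le_right (s l)) :
    ∃ f : M.O ⊤, ∀ k, M.res le_top f = s k := by
  obtain ⟨f, hf, -⟩ := TopCat.Sheaf.existsUnique_gluing' M.sheaf U ⊤ (fun _ => homOfLE le_top)
    (fun x _ => Opens.mem_iSup.2 (hU x)) s hs
  exact ⟨f, hf⟩

theorem eq_of_res_eq {ι : Type u} (U : ι → Opens M.carrier) (hU : ∀ x, ∃ k, x ∈ U k)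
    {f g : M.O ⊤} (h : ∀ k, M.res (le_top : U k ≤ ⊤) f = M.res le_top g) : f = g :=
  TopCat.Sheaf.eq_of_locally_eq' M.sheaf U ⊤ (fun _ => homOfLE le_top)
    (fun x _ => Opens.mem_iSup.2 (hU x)) f g h

end SuperSpace

namespace Supermanifold

open SuperSpace

variable {p q : ℕ} {M : Supermanifold.{u} p q} {w : ℝ} {i : ZMod 2}

theorem exists_gluing (s : ∀ c : M.Coords, M.O c.source)
    (hs : ∀ c d : M.Coords, M.res (inf_le_left : c.source ⊓ d.source ≤ c.source) (s c) =
      M.res inf_le_right (s d)) : ∃ f : M.O ⊤, ∀ c : M.Coords, M.res le_top f = s c :=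
  SuperSpace.exists_gluing (fun c : M.Coords => c.source) M.exists_chart s hs

theorem eq_of_res_eq {f g : M.O ⊤}
    (h : ∀ c : M.Coords, M.res (le_top : c.source ≤ ⊤) f = M.res le_top g) : f = g :=
  SuperSpace.eq_of_res_eq (fun c : M.Coords => c.source) M.exists_chart h

theorem VectorField.isSuperDer (X : M.VectorField i) (U : Opens M.carrier) :
    IsSuperDer (M.par U) i (X.app U) where
  mem j g hg := mem_homog_iff.1 (X.app_mem U j g (mem_homog_iff.2 hg))
  leibniz j g h hg := X.leibniz U j g h (mem_homog_iff.2 hg)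

theorem VectorField.res_coordDiv (X : M.VectorField i) (c : M.Coords) {U V : Opens M.carrier}
    (h : U ≤ V) (hV : V ≤ c.source) : M.res h (c.coordDiv hV i (X.app V)) =
      c.coordDiv (h.trans hV) i (X.app U) := by
  simp only [Chart.coordDiv, map_sum, map_smul, c.res_pderiv hV h, ← X.app_res, c.res_coord hV h]

namespace BasisVolume

/-- On a supermanifold with a nondegenerate volume form the Berezinians of the coordinate changes
are invertible. -/
theorem isUnit_berezinian (ρ : M.BasisVolume) (c d : M.Coords) : IsUnit (berezinian
    (c.jacobian (inf_le_left : c.source ⊓ d.source ≤ c.source) d inf_le_right)) := by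
  have h := ρ.toDensity.2 c d
  have h1 := (ρ.isUnit c).map (M.res (inf_le_left : c.source ⊓ d.source ≤ c.source))
  have h2 : IsHomog (M.par _) 0 (M.res (inf_le_right : c.source ⊓ d.source ≤ d.source)
      (ρ.toDensity.1 d)) := isHomog_res _ (mem_homog_iff.1 (ρ.even d))
  -- The invertible coefficient `ρ_x` is the product of the commuting factors `ρ_y` and `|Ber|^1`,
  -- so both are invertible.
  rw [h, ((c.isSuperComm inf_le_left).commute h2 _).isUnit_mul_iff] at h1
  exact c.isUnit_of_isUnit_absPow _ h1.2

end BasisVolume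

/-- The coefficients are prescribed, so only the transformation law is at stake; `ρ` supplies the
invertible Berezinians it needs. -/
theorem exists_isLieDerivative (ρ : M.BasisVolume) (X : M.VectorField i) (s : M.Density w) :
    ∃ t, IsLieDerivative X s t := by
  refine ⟨⟨fun c => X.app c.source (s.1 c) +
      w • (c.coordDiv le_rfl i (X.app c.source) * s.1 c), fun c d => ?_⟩, fun c => rfl⟩
  simp only [map_add, map_smul, map_mul, ← X.app_res, X.res_coordDiv]
  rw [s.2 c d]
  exact c.lieDerivative_transform d _ _ (X.isSuperDer _) (ρ.isUnit_berezinian c d) w _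

theorem isLieDerivative_lieDerivative (ρ : M.BasisVolume) (X : M.VectorField i)
    (s : M.Density w) : IsLieDerivative X s (lieDerivative X s) := by
  have h := exists_isLieDerivative ρ X s
  rw [lieDerivative, dif_pos h]
  exact h.choose_spec

theorem lieDerivative_apply (ρ : M.BasisVolume) (X : M.VectorField i) (s : M.Density w)
    (c : M.Coords) : (lieDerivative X s).1 c = X.app c.source (s.1 c) +
      w • (c.coordDiv le_rfl i (X.app c.source) * s.1 c) :=
  isLieDerivative_lieDerivative ρ X s c

namespace BasisVolume

variable (ρ : M.BasisVolume)

theorem isHomog (c : M.Coords) : IsHomog (M.par _) 0 (ρ.toDensity.1 c) :=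
  mem_homog_iff.1 (ρ.even c)

/-- The law `ρ_x = ρ_y |Ber|^1` is raised to the power `w`, using multiplicativity, `||Ber|^1|^w =
|Ber|^w` and the independence of powers from the chart. -/
theorem exists_isPower (w : ℝ) : ∃ t : M.Density w, IsPower ρ t := by
  refine ⟨⟨fun c => c.absPow le_rfl (ρ.toDensity.1 c) w, fun c d => ?_⟩, fun c => rfl⟩
  have h := ρ.toDensity.2 c d
  have hc := isHomog_res (inf_le_left : c.source ⊓ d.source ≤ c.source) (ρ.isHomog c)
  have hd := isHomog_res (inf_le_right : c.source ⊓ d.source ≤ d.source) (ρ.isHomog d)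
  have hcu := (ρ.isUnit c).map (M.res (inf_le_left : c.source ⊓ d.source ≤ c.source))
  have hdu := (ρ.isUnit d).map (M.res (inf_le_right : c.source ⊓ d.source ≤ d.source))
  have hB := c.isHomog_berezinian_jacobian d (inf_le_left : c.source ⊓ d.source ≤ c.source)
    inf_le_right
  have hBu := ρ.isUnit_berezinian c d
  rw [c.res_absPow le_rfl _ (ρ.isUnit c), d.res_absPow le_rfl _ (ρ.isUnit d), h,
    c.absPow_mul _ hd (c.isHomog_absPow _ hB 1) hdu (c.isUnit_absPow _ hBu 1),
    c.absPow_absPow_one _ hB hBu, c.absPow_eq_absPow d _ _ hd hdu]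

theorem isPower_power (w : ℝ) : IsPower ρ (ρ.power w) := by
  have h := ρ.exists_isPower w
  rw [power, dif_pos h]
  exact h.choose_spec

theorem power_apply (w : ℝ) (c : M.Coords) :
    (ρ.power w).1 c = c.absPow le_rfl (ρ.toDensity.1 c) w := ρ.isPower_power w c

theorem isHomog_power (w : ℝ) (c : M.Coords) : IsHomog (M.par _) 0 ((ρ.power w).1 c) := by
  rw [power_apply]
  exact c.isHomog_absPow _ (ρ.isHomog c) w

theorem isUnit_power (w : ℝ) (c : M.Coords) : IsUnit ((ρ.power w).1 c) := by
  rw [power_apply]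
  exact c.isUnit_absPow _ (ρ.isUnit c) w

end BasisVolume

theorem mulDensity_apply (f : M.O ⊤) (s : M.Density w) (c : M.Coords) :
    (mulDensity f s).1 c = M.res le_top f * s.1 c := rfl

/-- Every density is a unique multiple of a density with invertible coefficients. -/
theorem existsUnique_mulDensity {r : M.Density w} (hu : ∀ c : M.Coords, IsUnit (r.1 c)) (s : M.Density w) :
    ∃! f : M.O ⊤, s = mulDensity f r := by
  -- The factor `|Ber|^w` is common to `s` and `r`, so the local quotients agree on overlaps and
  -- glue.
  have hcomp : ∀ c d : M.Coords,
      M.res (inf_le_left : c.source ⊓ d.source ≤ c.source) (s.1 c * Ring.inverse (r.1 c)) =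
        M.res inf_le_right (s.1 d * Ring.inverse (r.1 d)) := by
    intro c d
    have hcu := (hu c).map (M.res (inf_le_left : c.source ⊓ d.source ≤ c.source))
    apply hcu.mul_right_cancel
    have e1 : M.res (inf_le_left : c.source ⊓ d.source ≤ c.source) (s.1 c * Ring.inverse (r.1 c)) *
        M.res inf_le_left (r.1 c) = M.res inf_le_left (s.1 c) := by
      rw [← map_mul, mul_assoc, Ring.inverse_mul_cancel _ (hu c), mul_one]
    have e2 : M.res (inf_le_right : c.source ⊓ d.source ≤ d.source)
        (s.1 d * Ring.inverse (r.1 d)) * M.res inf_le_right (r.1 d) =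
          M.res inf_le_right (s.1 d) := by
      rw [← map_mul, mul_assoc, Ring.inverse_mul_cancel _ (hu d), mul_one]
    rw [e1, r.2 c d, ← mul_assoc, e2, s.2 c d]
  obtain ⟨f, hf⟩ := exists_gluing (fun c => s.1 c * Ring.inverse (r.1 c)) hcomp
  refine ⟨f, Subtype.ext (funext fun c => ?_), fun g hg => eq_of_res_eq fun c => ?_⟩
  · rw [mulDensity_apply, hf, mul_assoc, Ring.inverse_mul_cancel _ (hu c), mul_one]
  · have h1 : s.1 c = M.res le_top g * r.1 c := congrArg (fun t : M.Density w => t.1 c) hg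
    rw [hf, h1, mul_assoc, Ring.mul_inverse_cancel _ (hu c), mul_one]

/-! ### Quotients, divergences and Lie derivatives relative to a volume form. -/

namespace BasisVolume

variable (ρ : M.BasisVolume)

theorem existsUnique_quotient (s : M.Density w) :
    ∃! f : M.O ⊤, s = mulDensity f (ρ.power w) :=
  existsUnique_mulDensity (ρ.isUnit_power w) s

theorem quotient_mulDensity (f : M.O ⊤) : ρ.quotient (mulDensity f (ρ.power w)) = f := by
  have h : ∃ σ, mulDensity f (ρ.power w) = mulDensity σ (ρ.power w) := ⟨f, rfl⟩
  rw [quotient, dif_pos h]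
  exact (ρ.existsUnique_quotient (mulDensity f (ρ.power w))).unique h.choose_spec rfl

theorem mulDensity_divergence (X : M.VectorField i) :
    mulDensity (ρ.divergence X) ρ.toDensity = lieDerivative X ρ.toDensity := by
  have h : ∃ g, mulDensity g ρ.toDensity = lieDerivative X ρ.toDensity := by
    obtain ⟨g, hg, -⟩ := existsUnique_mulDensity ρ.isUnit
      (lieDerivative X ρ.toDensity)
    exact ⟨g, hg.symm⟩
  rw [divergence, dif_pos h]
  exact h.choose_spec

theorem res_divergence_mul (X : M.VectorField i) (c : M.Coords) :
    M.res le_top (ρ.divergence X) * ρ.toDensity.1 c = X.app c.source (ρ.toDensity.1 c) +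
      c.coordDiv le_rfl i (X.app c.source) * ρ.toDensity.1 c := by
  have h := congrArg (fun t : M.Density 1 => t.1 c) (ρ.mulDensity_divergence X)
  simpa only [mulDensity_apply, lieDerivative_apply ρ, one_smul] using h

theorem eq_divergence {X : M.VectorField i} {g : M.O ⊤}
    (h : ∀ c : M.Coords, M.res le_top g * ρ.toDensity.1 c = X.app c.source (ρ.toDensity.1 c) +
      c.coordDiv le_rfl i (X.app c.source) * ρ.toDensity.1 c) : g = ρ.divergence X :=
  eq_of_res_eq fun c => (ρ.isUnit c).mul_right_cancel ((h c).trans (ρ.res_divergence_mul X c).symm)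

theorem isHomog_res_divergence (X : M.VectorField i) (c : M.Coords) :
    IsHomog (M.par c.source) i (M.res le_top (ρ.divergence X)) := by
  have h : M.res le_top (ρ.divergence X) = (X.app c.source (ρ.toDensity.1 c) +
      c.coordDiv le_rfl i (X.app c.source) * ρ.toDensity.1 c) *
        Ring.inverse (ρ.toDensity.1 c) := by
    rw [← res_divergence_mul, mul_assoc, Ring.mul_inverse_cancel _ (ρ.isUnit c), mul_one]
  have h1 := (X.isSuperDer c.source).mem 0 _ (ρ.isHomog c)
  have h2 := (c.isHomog_coordDiv le_rfl (X.isSuperDer c.source)).mul (ρ.isHomog c)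
  rw [h]
  simpa using (h1.add h2).mul (ρ.isHomog c).inverse

/-- The Lie derivative of `f ρ^w` is `(X f + w (div X) f) ρ^w`. -/
theorem lieDerivative_mulDensity_power (X : M.VectorField i) (f : M.O ⊤) (c : M.Coords) :
    (lieDerivative X (mulDensity f (ρ.power w))).1 c =
      (X.app c.source (M.res le_top f) +
        w • (M.res le_top (ρ.divergence X) * M.res le_top f)) * (ρ.power w).1 c := by
  have H := c.isSuperComm le_rfl
  have hX := X.isSuperDer c.source
  have hr := ρ.isHomog c
  have hru := ρ.isUnit c
  have hdiv := ρ.res_divergence_mul X c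
  have hh := ρ.isHomog_power w c
  have e := c.mul_map_absPow le_rfl hX hr hru w
  rw [← ρ.power_apply] at e
  rw [lieDerivative_apply ρ, mulDensity_apply]
  generalize ρ.toDensity.1 c = r at *
  generalize (ρ.power w).1 c = h at *
  generalize c.coordDiv le_rfl i (X.app c.source) = δ at *
  generalize M.res (le_top : c.source ≤ ⊤) (ρ.divergence X) = G at *
  generalize M.res (le_top : c.source ≤ ⊤) f = F at *
  have hXr : X.app c.source r = (G - δ) * r := by
    rw [sub_mul, hdiv, add_sub_cancel_right]
  -- The power equation turns `X ρ_x = (div_ρ X - div_x X) ρ_x` into the analogue for `ρ^w`. The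
  -- coordinate divergence then cancels the one in the Lie derivative.
  have hXh : X.app c.source h = w • ((G - δ) * h) := by
    apply hru.mul_left_cancel
    rw [e, hXr, mul_smul_comm, ← mul_assoc r, H.even_mul hr, mul_assoc _ r, H.even_mul hr h,
      ← mul_assoc, H.even_mul hh, mul_assoc]
  rw [← H.even_mul hh F, hX.leibniz_even hh, hXh, add_mul, H.even_mul hh (X.app c.source F),
    smul_mul_assoc, smul_mul_assoc, mul_assoc, H.even_mul hh F, sub_mul, smul_sub, mul_assoc G]
  abel

end BasisVolume

end Supermanifold

/-! ## The odd Laplace operator -/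

namespace Supermanifold

open SuperSpace

variable {p q : ℕ} {M : Supermanifold.{u} p q} {w : ℝ} {i j : ZMod 2}

theorem component_of_mem {f : M.O ⊤} (hf : f ∈ M.homog ⊤ i) : M.component i f = f := by
  rw [component, mem_homog.1 hf, paritySign_smul_smul, ← two_smul ℝ f, smul_smul]
  norm_num

theorem component_add_one_of_mem {f : M.O ⊤} (hf : f ∈ M.homog ⊤ i) :
    M.component (i + 1) f = 0 := by
  rw [component, mem_homog.1 hf, paritySign_add, paritySign_one, mul_neg, mul_one, neg_smul,
    paritySign_smul_smul, add_neg_cancel, smul_zero]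

theorem component_add (f g : M.O ⊤) :
    M.component i (f + g) = M.component i f + M.component i g := by
  simp only [component, map_add, smul_add]
  abel

namespace OddPoisson

variable (P : M.OddPoisson) (ρ : M.BasisVolume)

theorem hamiltonian_app {f : M.O ⊤} (hf : f ∈ M.homog ⊤ i) (U : Opens M.carrier) (g : M.O U) :
    (P.hamiltonian hf).app U g = paritySign (i + 1) • P.bracket U (M.res le_top f) g := rfl

theorem divergence_hamiltonian_congr {f g : M.O ⊤} (h : f = g) (hf : f ∈ M.homog ⊤ i)
    (hg : g ∈ M.homog ⊤ i) :
    ρ.divergence (P.hamiltonian hf) = ρ.divergence (P.hamiltonian hg) := by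
  subst h
  rfl

theorem divergence_hamiltonian_add {f g : M.O ⊤} (hf : f ∈ M.homog ⊤ i) (hg : g ∈ M.homog ⊤ i)
    (hfg : f + g ∈ M.homog ⊤ i) : ρ.divergence (P.hamiltonian hfg) =
      ρ.divergence (P.hamiltonian hf) + ρ.divergence (P.hamiltonian hg) := by
  refine (ρ.eq_divergence fun c => ?_).symm
  have h : (P.hamiltonian hfg).app c.source =
      (P.hamiltonian hf).app c.source + (P.hamiltonian hg).app c.source := by
    ext t
    simp only [hamiltonian_app, LinearMap.add_apply, map_add, smul_add]
  rw [h, Chart.coordDiv_add, map_add, add_mul, ρ.res_divergence_mul, ρ.res_divergence_mul,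
    LinearMap.add_apply, add_mul]
  abel

theorem divergence_hamiltonian_zero (h : (0 : M.O ⊤) ∈ M.homog ⊤ i) :
    ρ.divergence (P.hamiltonian h) = 0 := by
  have h1 := P.divergence_hamiltonian_add ρ h h (by simp)
  rw [P.divergence_hamiltonian_congr ρ (add_zero 0) _ h] at h1
  exact left_eq_add.1 h1

theorem laplacian_of_mem {f : M.O ⊤} (hf : f ∈ M.homog ⊤ i) :
    P.laplacian ρ f = ρ.divergence (P.hamiltonian hf) := by
  rcases ZMod.two_cases i with rfl | rfl
  · have h : M.component 1 f = 0 := component_add_one_of_mem hf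
    rw [laplacian, P.divergence_hamiltonian_congr ρ (component_of_mem hf) _ hf,
      P.divergence_hamiltonian_congr ρ h _ (Submodule.zero_mem _),
      P.divergence_hamiltonian_zero, add_zero]
  · have h : M.component 0 f = 0 := component_add_one_of_mem hf
    rw [laplacian, P.divergence_hamiltonian_congr ρ (component_of_mem hf) _ hf,
      P.divergence_hamiltonian_congr ρ h _ (Submodule.zero_mem _),
      P.divergence_hamiltonian_zero, zero_add]

theorem laplacian_add (f g : M.O ⊤) :
    P.laplacian ρ (f + g) = P.laplacian ρ f + P.laplacian ρ g := by
  have h : ∀ i, ρ.divergence (P.hamiltonian (M.component_mem i (f + g))) =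
      ρ.divergence (P.hamiltonian (M.component_mem i f)) +
        ρ.divergence (P.hamiltonian (M.component_mem i g)) := fun i => by
    rw [P.divergence_hamiltonian_congr ρ (component_add f g) _
      (Submodule.add_mem _ (M.component_mem i f) (M.component_mem i g)),
      P.divergence_hamiltonian_add]
  rw [laplacian, h, h, laplacian, laplacian]
  abel

theorem isHomog_res_laplacian {f : M.O ⊤} (hf : f ∈ M.homog ⊤ i) (c : M.Coords) :
    IsHomog (M.par c.source) (i + 1) (M.res le_top (P.laplacian ρ f)) := by
  rw [P.laplacian_of_mem ρ hf]
  exact ρ.isHomog_res_divergence _ c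

theorem mul_mem_homog {f g : M.O ⊤} (hf : f ∈ M.homog ⊤ i) (hg : g ∈ M.homog ⊤ j) :
    f * g ∈ M.homog ⊤ (i + j) :=
  mem_homog_iff.2 ((mem_homog_iff.1 hf).mul (mem_homog_iff.1 hg))

/-- `X_σ f = (-1)^{fσ} X_f σ`. -/
theorem hamiltonian_symm {f g : M.O ⊤} (hf : f ∈ M.homog ⊤ i) (hg : g ∈ M.homog ⊤ j)
    (U : Opens M.carrier) : (P.hamiltonian hg).app U (M.res le_top f) =
      paritySign (i * j) • (P.hamiltonian hf).app U (M.res le_top g) := by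
  rw [hamiltonian_app, hamiltonian_app, P.bracket_symm U j i _ _ (res_mem_homog le_top hg)
    (res_mem_homog le_top hf), ← neg_smul, smul_smul, smul_smul]
  congr 1
  rcases ZMod.two_cases i with rfl | rfl <;> rcases ZMod.two_cases j with rfl | rfl <;>
    simp [show (1 + 1 : ZMod 2) = 0 from rfl]

/-- The Hamiltonian vector field of a product. -/
theorem hamiltonian_mul_app {f g : M.O ⊤} (hf : f ∈ M.homog ⊤ i) (hg : g ∈ M.homog ⊤ j)
    (c : M.Coords) : (P.hamiltonian (mul_mem_homog hf hg)).app c.source =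
      paritySign i • (LinearMap.mulLeft ℝ (M.res le_top f) ∘ₗ (P.hamiltonian hg).app c.source) +
      paritySign (j + i * j) •
        (LinearMap.mulLeft ℝ (M.res le_top g) ∘ₗ (P.hamiltonian hf).app c.source) := by
  have H := c.isSuperComm le_rfl
  have hF := res_mem_homog (le_top : c.source ≤ ⊤) hf
  have hG := res_mem_homog (le_top : c.source ≤ ⊤) hg
  have hFG := res_mem_homog (le_top : c.source ≤ ⊤) (mul_mem_homog hf hg)
  ext t
  refine H.homog_induction (P := fun t => (P.hamiltonian (mul_mem_homog hf hg)).app c.source t =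
      (paritySign i • (LinearMap.mulLeft ℝ (M.res le_top f) ∘ₗ (P.hamiltonian hg).app c.source) +
      paritySign (j + i * j) •
        (LinearMap.mulLeft ℝ (M.res le_top g) ∘ₗ (P.hamiltonian hf).app c.source)) t)
    (fun k t ht => ?_) (fun a b ha hb => ?_) t
  · have ht' := mem_homog_iff.2 ht
    simp only [LinearMap.add_apply, LinearMap.smul_apply, LinearMap.comp_apply,
      LinearMap.mulLeft_apply, hamiltonian_app]
    -- The Leibniz rule is available in the second argument, so the product is moved there by
    -- antisymmetry and the two resulting brackets are moved back.
    rw [P.bracket_symm _ _ _ _ _ hFG ht', map_mul, P.leibniz _ _ _ _ _ _ ht' hF,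
      P.bracket_symm _ _ _ _ _ hF ht', P.bracket_symm _ _ _ _ _ hG ht',
      H.comm _ _ _ _ (mem_homog_iff.1 (P.bracket_mem _ _ _ _ _ ht' hF)) (mem_homog_iff.1 hG)]
    generalize P.bracket c.source t (M.res le_top f) = A
    generalize P.bracket c.source t (M.res le_top g) = B
    simp only [mul_neg, mul_smul_comm, smul_smul, smul_add, neg_add, ← neg_smul]
    rw [add_comm]
    congr 2 <;>
    · rcases ZMod.two_cases i with rfl | rfl <;> rcases ZMod.two_cases j with rfl | rfl <;>
        rcases ZMod.two_cases k with rfl | rfl <;>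
        simp [show (1 + 1 : ZMod 2) = 0 from rfl]
  · rw [map_add, map_add, ha, hb]

/-- The odd Laplace operator is a second order operator that generates the bracket. -/
theorem laplacian_mul_of_mem {f g : M.O ⊤} (hf : f ∈ M.homog ⊤ i) (hg : g ∈ M.homog ⊤ j) :
    P.laplacian ρ (f * g) = P.laplacian ρ f * g + paritySign i • (f * P.laplacian ρ g) +
      (2 : ℝ) • (P.hamiltonian hf).app ⊤ g := by
  refine eq_of_res_eq fun c => (ρ.isUnit c).mul_right_cancel ?_
  have H := c.isSuperComm le_rfl
  have hF := mem_homog_iff.1 (res_mem_homog (le_top : c.source ≤ ⊤) hf)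
  have hG := mem_homog_iff.1 (res_mem_homog (le_top : c.source ≤ ⊤) hg)
  have hΔf := P.isHomog_res_laplacian ρ hf c
  have hXf := (P.hamiltonian hf).isSuperDer c.source
  have hXg := (P.hamiltonian hg).isSuperDer c.source
  have ef := ρ.res_divergence_mul (P.hamiltonian hf) c
  have eg := ρ.res_divergence_mul (P.hamiltonian hg) c
  have esymm := P.hamiltonian_symm hf hg c.source
  rw [P.laplacian_of_mem ρ (mul_mem_homog hf hg), ρ.res_divergence_mul, P.hamiltonian_mul_app hf hg]
  -- The divergences of `f X_g` and `g X_f` contain the extra terms `X_g f` and `X_f g`. They are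
  -- the source of the term `2 X_f g`.
  have d1 := c.coordDiv_mulLeft le_rfl hF hXg
  have d2 := c.coordDiv_mulLeft le_rfl hG hXf
  rw [← add_assoc] at d1 d2
  rw [add_comm j i] at d2
  rw [P.laplacian_of_mem ρ hf] at hΔf ⊢
  rw [P.laplacian_of_mem ρ hg, Chart.coordDiv_add, Chart.coordDiv_smul, Chart.coordDiv_smul, d1, d2,
    esymm]
  simp only [map_add, map_mul, map_smul, ← (P.hamiltonian hf).app_res]
  have hcomm := H.comm _ _ _ _ hG hΔf
  have hu := ρ.isUnit c
  generalize (P.hamiltonian hf).app c.source (M.res le_top g) = Y at *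
  generalize c.coordDiv le_rfl (i + 1) ((P.hamiltonian hf).app c.source) = δf at *
  generalize c.coordDiv le_rfl (j + 1) ((P.hamiltonian hg).app c.source) = δg at *
  generalize M.res (le_top : c.source ≤ ⊤) (ρ.divergence (P.hamiltonian hf)) = Δf at *
  generalize M.res (le_top : c.source ≤ ⊤) (ρ.divergence (P.hamiltonian hg)) = Δg at *
  generalize M.res (le_top : c.source ≤ ⊤) f = F at *
  generalize M.res (le_top : c.source ≤ ⊤) g = G at *
  simp only [LinearMap.add_apply, LinearMap.smul_apply, LinearMap.comp_apply,
    LinearMap.mulLeft_apply]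
  generalize (P.hamiltonian hf).app c.source (ρ.toDensity.1 c) = Af at *
  generalize (P.hamiltonian hg).app c.source (ρ.toDensity.1 c) = Ag at *
  generalize ρ.toDensity.1 c = r at *
  have hGΔ : Δf * G = paritySign (j * (i + 1)) • (G * Δf) := by
    rw [hcomm, paritySign_smul_smul]
  -- Derivatives of `ρ_x` are traded for divergences relative to `ρ`, after which all coordinate
  -- divergences cancel.
  have e3 : F * Ag = F * (Δg * r) - F * (δg * r) := by rw [eg, mul_add, add_sub_cancel_right]
  have e4 : G * Af = G * (Δf * r) - G * (δf * r) := by rw [ef, mul_add, add_sub_cancel_right]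
  rw [hGΔ, e3, e4]
  have s1 : paritySign (j * (i + 1)) = paritySign (j + i * j) := by
    congr 1
    ring
  -- `s2` and `s3` are the total signs of the two extra terms, after rewriting `X_g f` as `± X_f g`.
  -- Both are `+1`, so the terms add up instead of cancelling.
  have s2 : paritySign i * (paritySign (j * i + 1 * i) * paritySign (i * j)) = 1 := by
    rcases ZMod.two_cases i with rfl | rfl <;> rcases ZMod.two_cases j with rfl | rfl <;>
      simp [show (1 + 1 : ZMod 2) = 0 from rfl]
  have s3 : paritySign (j + i * j) * paritySign (i * j + 1 * j) = 1 := by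
    rcases ZMod.two_cases i with rfl | rfl <;> rcases ZMod.two_cases j with rfl | rfl <;>
      simp [show (1 + 1 : ZMod 2) = 0 from rfl]
  simp only [add_mul, smul_add, smul_sub, smul_mul_assoc, mul_assoc, smul_smul, s1, s2, s3,
    one_smul, two_smul]
  abel

theorem laplacian_mul {f : M.O ⊤} (hf : f ∈ M.homog ⊤ i) (g : M.O ⊤) :
    P.laplacian ρ (f * g) = P.laplacian ρ f * g + paritySign i • (f * P.laplacian ρ g) +
      (2 : ℝ) • (P.hamiltonian hf).app ⊤ g := by
  have h : g = M.component 0 g + M.component 1 g := by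
    simp only [component, paritySign_zero, paritySign_one, one_smul, neg_smul]
    rw [← smul_add, add_add_add_comm, add_neg_cancel, add_zero, ← two_smul ℝ g, smul_smul]
    norm_num
  rw [h, mul_add, laplacian_add, P.laplacian_mul_of_mem ρ hf (M.component_mem 0 g),
    P.laplacian_mul_of_mem ρ hf (M.component_mem 1 g), laplacian_add, map_add]
  simp only [mul_add, smul_add]
  abel

theorem mulDensity_laplacian {f : M.O ⊤} (hf : f ∈ M.homog ⊤ i) :
    mulDensity (P.laplacian ρ f) ρ.toDensity =
      lieDerivative (P.hamiltonian hf) ρ.toDensity := by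
  rw [P.laplacian_of_mem ρ hf, ρ.mulDensity_divergence]

theorem densityLaplacian_mulDensity (f : M.O ⊤) :
    P.densityLaplacian ρ (mulDensity f (ρ.power w)) =
      mulDensity (P.laplacian ρ f) (ρ.power w) := by
  rw [densityLaplacian, ρ.quotient_mulDensity]

/-- For `s = σ ρ^w` the product formula leaves `((Δf) σ + 2 X_f σ) ρ^w`, while `2 L_{X_f} s`
accounts for `(2 X_f σ + 2w (Δf) σ) ρ^w`. -/
theorem densityLaplacian_commutator {f : M.O ⊤} (hf : f ∈ M.homog ⊤ i) (s : M.Density w) :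
    P.densityLaplacian ρ (mulDensity f s) - paritySign i • mulDensity f (P.densityLaplacian ρ s) =
      (2 : ℝ) • lieDerivative (P.hamiltonian hf) s +
        mulDensity ((1 - 2 * w) • P.laplacian ρ f) s := by
  obtain ⟨σ, rfl, -⟩ := ρ.existsUnique_quotient s
  have hmul : mulDensity f (mulDensity σ (ρ.power w)) = mulDensity (f * σ) (ρ.power w) := by
    refine Subtype.ext (funext fun c => ?_)
    simp only [mulDensity_apply, map_mul, mul_assoc]
  rw [hmul, densityLaplacian_mulDensity, densityLaplacian_mulDensity, P.laplacian_mul ρ hf]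
  refine Subtype.ext (funext fun c => ?_)
  change (mulDensity _ _).1 c - paritySign i • (mulDensity _ _).1 c =
    (2 : ℝ) • (lieDerivative _ _).1 c + (mulDensity _ _).1 c
  rw [ρ.lieDerivative_mulDensity_power, ← P.laplacian_of_mem ρ hf]
  simp only [mulDensity_apply, map_add, map_sub, map_smul, map_mul, ← (P.hamiltonian hf).app_res,
    add_mul, sub_mul,
    smul_add, smul_mul_assoc, mul_assoc, smul_smul, sub_smul, one_smul]
  abel

/-- When `Δ = 0`, the product formula reduces to `2 X_f g = 0` for homogeneous `f`; linearity does
the rest. -/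
theorem bracket_eq_zero_of_laplacian_eq_zero (h : ∀ f : M.O ⊤, P.laplacian ρ f = 0)
    (f g : M.O ⊤) : P.bracket ⊤ f g = 0 := by
  have h1 : ∀ (i : ZMod 2) (f : M.O ⊤), f ∈ M.homog ⊤ i → P.bracket ⊤ f g = 0 := by
    intro i f hf
    have h2 := P.laplacian_mul ρ hf g
    have h3 : M.res (le_top : (⊤ : Opens M.carrier) ≤ ⊤) f = f := by
      have := congrArg (fun t => t.hom f) (M.sheaf.presheaf.map_id (op ⊤))
      exact this
    rw [h, h, h, zero_mul, mul_zero, smul_zero, add_zero, zero_add, hamiltonian_app, h3,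
      smul_smul] at h2
    refine (smul_eq_zero.1 h2.symm).resolve_left (mul_ne_zero two_ne_zero ?_)
    exact left_ne_zero_of_mul_eq_one (paritySign_mul_self (i + 1))
  have hf : f = M.component 0 f + M.component 1 f := by
    simp only [component, paritySign_zero, paritySign_one, one_smul, neg_smul]
    rw [← smul_add, add_add_add_comm, add_neg_cancel, add_zero, ← two_smul ℝ f, smul_smul]
    norm_num
  rw [hf, map_add, LinearMap.add_apply, h1 0 _ (M.component_mem 0 f),
    h1 1 _ (M.component_mem 1 f), add_zero]

end OddPoisson

end Supermanifold

/-- The first five conjuncts say that the objects in the commutator formula are well defined: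
the Lie derivative of densities, the power of a volume form, the quotient by it, and the Laplacians
on functions and on densities. The last two are the commutator formula and the exceptional role of
the weight `1/2`. -/
theorem mainTheorem8 {p q : ℕ} (M : Supermanifold.{u} p q) (P : M.OddPoisson)
    (ρ : M.BasisVolume) (w : ℝ) :
    (∀ (i : ZMod 2) (X : M.VectorField i) (v : ℝ) (s : M.Density v),
      Supermanifold.IsLieDerivative X s (Supermanifold.lieDerivative X s)) ∧
    Supermanifold.IsPower ρ (ρ.power w) ∧
    (∀ s : M.Density w, ∃! σ : M.O ⊤, s = Supermanifold.mulDensity σ (ρ.power w)) ∧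
    (∀ (i : ZMod 2) (f : M.O ⊤) (hf : f ∈ M.homog ⊤ i),
      Supermanifold.mulDensity (P.laplacian ρ f) ρ.toDensity =
        Supermanifold.lieDerivative (P.hamiltonian hf) ρ.toDensity) ∧
    (∀ σ : M.O ⊤, P.densityLaplacian ρ (Supermanifold.mulDensity σ (ρ.power w)) =
      Supermanifold.mulDensity (P.laplacian ρ σ) (ρ.power w)) ∧
    (∀ (i : ZMod 2) (f : M.O ⊤) (hf : f ∈ M.homog ⊤ i) (s : M.Density w),
      P.densityLaplacian ρ (Supermanifold.mulDensity f s) -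
          paritySign i • Supermanifold.mulDensity f (P.densityLaplacian ρ s) =
        (2 : ℝ) • Supermanifold.lieDerivative (P.hamiltonian hf) s +
          Supermanifold.mulDensity ((1 - 2 * w) • P.laplacian ρ f) s) ∧
    ((∃ f g : M.O ⊤, P.bracket ⊤ f g ≠ 0) →
      ((∀ f : M.O ⊤, (1 - 2 * w) • P.laplacian ρ f = 0) ↔ w = 1 / 2)) := by
  refine ⟨fun i X v s => Supermanifold.isLieDerivative_lieDerivative ρ X s, ρ.isPower_power w,
    fun s => ρ.existsUnique_quotient s, fun i f hf => P.mulDensity_laplacian ρ hf,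
    fun σ => P.densityLaplacian_mulDensity ρ σ, fun i f hf s => P.densityLaplacian_commutator ρ hf s,
    fun ⟨f, g, hfg⟩ => ⟨fun h => ?_, fun h f => ?_⟩⟩
  -- For `w ≠ 1/2` the factor `1 - 2w` can be divided out, so `Δ` vanishes and with it the bracket.
  · by_contra hw
    refine hfg (P.bracket_eq_zero_of_laplacian_eq_zero ρ (fun f => ?_) f g)
    refine (smul_eq_zero.1 (h f)).resolve_left fun h0 => hw ?_
    linarith
  · rw [h]
    norm_num
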